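/- Let $(\mathbb X,\nu)$ be a $\sigma$-finite measure space (e.g. $\mathbb R^d$ with Lebesgue measure, $\nu(dx)=dx$), let $\mathbb U$ be a compact metrizable space with its Borel $\sigma$-algebra, and let $k(x\mid u)\ge 0$ be a jointly measurable kernel such that $x\mapsto k(x\mid u)$ is a probability density with respect to $\nu$ for every $u\in\mathbb U$. For a probability distribution $P$ on $\mathbb U$ write $m_P(x)=\int_{\mathbb U}k(x\mid u)\,P(du)$. Assume that the kernel is such that $Q_t\to Q_\infty$ weakly implies $m_{Q_t}(x)\to m_{Q_\infty}(x)$ for $\nu$-almost every $x$, for every sequence $(Q_t)$ of probability distributions on $\mathbb U$. Let $\mathcal P$ be a weakly dense set of probability distributions on $\mathbb U$ (for instance all of them), $\overline{\mathcal P}$ its closure in the weak topology, and $\mathscr M=\{m_P:P\in\overline{\mathcal P}\}$. Let $X_1,X_2,\ldots$ be independent and identically distributed with density $m^\star$ with respect to $\nu$, and for densities $m$ let $K(m^\star,m)=\int\log\{m^\star(x)/m(x)\}\,m^\star(x)\,\nu(dx)\in[0,\infty]$ be the Kullback--Leibler divergence; assume that $K(m^\star,m)<\infty$ for at least one $m\in\mathscr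 M$. Let $P_0$ be a probability distribution whose support is $\mathbb U$, let $w_i=a/(i+1)$ with $0<a<\frac29$, and define the predictive recursion (PR) estimates by $$P_i(du)=(1-w_i)\,P_{i-1}(du)+w_i\,\frac{k(X_i\mid u)\,P_{i-1}(du)}{\int_{\mathbb U}k(X_i\mid v)\,P_{i-1}(dv)},\qquad i\ge 1,$$ and $m_n=m_{P_n}$, $n\ge 0$. Suppose that $$\sup_{u\in\mathbb U}\int\Bigl\{\frac{k(x\mid u)}{m_0(x)}\Bigr\}^2 m^\star(x)\,\nu(dx)<\infty .$$ Then $K(m^\star,m_n)\to\inf_{m\in\mathscr M}K(m^\star,m)$ almost surely. In particular, if $m^\star\in\mathscr M$ (up to $\nu$-almost everywhere equality), then $K(m^\star,m_n)\to 0$ almost surely. -/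

import Mathlib

open MeasureTheory ProbabilityTheory Filter Topology
open scoped ENNReal NNReal

namespace PredRec

/-- The mixture density `m_P(x) = ∫ k(x | u) P(du)`; `k x u` stands for `k(x | u)`. -/
noncomputable def mixture {𝕏 𝕌 : Type*} [MeasurableSpace 𝕌]
    (k : 𝕏 → 𝕌 → ℝ≥0) (P : Measure 𝕌) (x : 𝕏) : ℝ≥0∞ :=
  ∫⁻ u, (k x u : ℝ≥0∞) ∂P

/-- One update of predictive recursion with weight `w` and data point `x`:
`P'(du) = (1 - w) P(du) + w k(x | u) P(du) / ∫ k(x | v) P(dv)`. -/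
noncomputable def update {𝕏 𝕌 : Type*} [MeasurableSpace 𝕌]
    (k : 𝕏 → 𝕌 → ℝ≥0) (w : ℝ) (x : 𝕏) (P : Measure 𝕌) : Measure 𝕌 :=
  ENNReal.ofReal (1 - w) • P +
    ENNReal.ofReal w • P.withDensity (fun u => (k x u : ℝ≥0∞) / mixture k P x)

/-- The predictive recursion estimates `P_0, P_1, P_2, …` of the mixing distribution, computed
from the weights `w 1, w 2, …` and the data `x 1, x 2, …` (the values at index `0` are not used). -/
noncomputable def estimate {𝕏 𝕌 : Type*} [MeasurableSpace 𝕌]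
    (k : 𝕏 → 𝕌 → ℝ≥0) (w : ℕ → ℝ) (P₀ : Measure 𝕌) (x : ℕ → 𝕏) : ℕ → Measure 𝕌
  | 0 => P₀
  | n + 1 => update k (w (n + 1)) (x (n + 1)) (estimate k w P₀ x n)

/-- The Kullback--Leibler divergence `K(f, g) = ∫ log (f / g) f dν` of two probability densities
with respect to `ν`, with values in `[0, ∞]`. -/
noncomputable def KL {𝕏 : Type*} [MeasurableSpace 𝕏] (ν : Measure 𝕏) (f g : 𝕏 → ℝ≥0∞) : ℝ≥0∞ :=
  InformationTheory.klDiv (ν.withDensity f) (ν.withDensity g)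

/-- The class `𝓜(k, 𝒟)` of all mixtures `m_P`, where `P` ranges over the closure of `𝒟` in the
topology of weak convergence of probability measures. -/
def mixtureClass {𝕏 𝕌 : Type*} [TopologicalSpace 𝕌] [MeasurableSpace 𝕌] [OpensMeasurableSpace 𝕌]
    (k : 𝕏 → 𝕌 → ℝ≥0) (𝒟 : Set (ProbabilityMeasure 𝕌)) : Set (𝕏 → ℝ≥0∞) :=
  (fun P : ProbabilityMeasure 𝕌 => mixture k (P : Measure 𝕌)) '' closure 𝒟

end PredRec

set_option linter.unusedSectionVars false

namespace PredRec

/-! ### Elementary inequalities -/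

/-! Let M be the law of the data and write `gain P` for the M-mean of log(m_P/m_0). Then K(m*, m_P)
= K(m*, m_0) - `gain P`, so the claim is that `gain P_n` tends almost surely to its supremum S over
all mixtures. The proof runs two stochastic approximation arguments, both using log(1+y) ≥ y - 2y²
for the multiplicative effect of one update.

Stability. Each update keeps at least the fraction 1 - w of the previous measure, so P_n ≥
(n+1)^(-a) P_0. Together with the second moment condition this bounds the moments of k/m_{P_n}. In
`RegularKernel.gain_drift` the first-order term of the mean change of the gain is w(E[overlap] - 1),
which is nonnegative by Cauchy–Schwarz, and the second-order term is O(w²(n+1)^(4a)). The errors are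
summable for a < 1/4, hence for a < 2/9. Adding the accumulated errors makes the gain a
submartingale bounded above, so it converges almost surely and its means converge to some l.

Identification. Let Q dominate a positive multiple of P_0 and have bounded density with respect to
P_0. By `RegularKernel.logDens_drift` the mean of ∫ log(dP_n/dP_0) dQ increases by at least
w_n(`gain Q` - E `gain P_n`) up to a summable error. This quantity is bounded above and ∑ w_n = ∞,
so l ≥ `gain Q` (`le_limit_of_drift`). Such Q come arbitrarily close to S: smooth a near-optimal
distribution over small balls, blend it with P_0, and apply Fatou (`RegularKernel.exists_gain_ge`).
Hence l ≥ S. Since `gain P_n` ≤ S almost surely, Fatou for S - `gain P_n` makes the almost sure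
limit equal to S (`RegularKernel.ae_tendsto_gain`). -/

theorem sq_lintegral_le {α : Type*} [MeasurableSpace α] (P : Measure α) (hP : P Set.univ ≤ 1)
    {f : α → ℝ≥0∞} (hf : AEMeasurable f P) : (∫⁻ u, f u ∂P) ^ 2 ≤ ∫⁻ u, f u ^ 2 ∂P := by
  have h := ENNReal.lintegral_mul_le_Lp_mul_Lq P (p := 2) (q := 2) 
    ⟨by norm_num, by norm_num, by norm_num⟩
    hf (aemeasurable_const (b := (1 : ℝ≥0∞)))
  simp only [Pi.mul_apply, mul_one, ENNReal.rpow_ofNat] at h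
  calc (∫⁻ u, f u ∂P) ^ 2
      ≤ ((∫⁻ u, f u ^ 2 ∂P) ^ (1 / 2 : ℝ)) ^ 2 := by
        gcongr
        refine h.trans (mul_le_of_le_one_right' ?_)
        exact ENNReal.rpow_le_one (by simpa using hP) (by norm_num)
    _ = ∫⁻ u, f u ^ 2 ∂P := by
        rw [← ENNReal.rpow_natCast, ← ENNReal.rpow_mul]
        norm_num

theorem one_le_lintegral_sq {α : Type*} [MeasurableSpace α] (P : Measure α)
    (hP : P Set.univ ≤ 1) {f : α → ℝ≥0∞} (hf : Measurable f) (h1 : 1 ≤ ∫⁻ u, f u ∂P) :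
    1 ≤ ∫⁻ u, f u ^ 2 ∂P :=
  (one_le_pow₀ h1).trans (sq_lintegral_le P hP hf.aemeasurable)

/-- From log t ≥ 1 - 1/t; the gap is y²(1+2y)/(1+y). With y = w(g-1) and g ≥ 0, the condition on y
follows from w ≤ 1/2. -/
theorem sub_two_mul_sq_le_log {y : ℝ} (hy : -(1 / 2) ≤ y) :
    y - 2 * y ^ 2 ≤ Real.log (1 + y) := by
  have h0 : 0 < 1 + y := by linarith
  have h := Real.one_sub_inv_le_log_of_pos h0
  refine le_trans ?_ h
  have : 1 - (1 + y)⁻¹ - (y - 2 * y ^ 2) = y ^ 2 * (1 + 2 * y) / (1 + y) := by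
    field_simp
    ring
  have h2 : 0 ≤ y ^ 2 * (1 + 2 * y) / (1 + y) := by
    apply div_nonneg (mul_nonneg (sq_nonneg _) (by linarith)) h0.le
  linarith

/-- Expectation of `log (1 - w + w g)` for a nonnegative `g` with second moment at most `A`. -/
theorem le_integral_log_mix {Z : Type*} [MeasurableSpace Z] (ρ : Measure Z)
    [IsProbabilityMeasure ρ] {g : Z → ℝ≥0∞} (hg : Measurable g) {A : ℝ} (hA : 0 ≤ A)
    (h2 : ∫⁻ z, g z ^ 2 ∂ρ ≤ ENNReal.ofReal A) {w : ℝ} (hw0 : 0 ≤ w) (hw : w ≤ 1 / 2) :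
    Integrable (fun z => (g z).toReal) ρ ∧
    Integrable (fun z => Real.log (1 - w + w * (g z).toReal)) ρ ∧
    w * (∫ z, (g z).toReal ∂ρ - 1) - 2 * w ^ 2 * (A + 1) ≤
      ∫ z, Real.log (1 - w + w * (g z).toReal) ∂ρ := by
  set r : Z → ℝ := fun z => (g z).toReal with hr
  have hrm : Measurable r := hg.ennreal_toReal
  have hr0 : ∀ z, 0 ≤ r z := fun z => ENNReal.toReal_nonneg
  have hsq : ∫⁻ z, ENNReal.ofReal (r z ^ 2) ∂ρ ≤ ENNReal.ofReal A := by
    refine le_trans (lintegral_mono fun z => ?_) h2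
    rw [ENNReal.ofReal_pow (hr0 z)]
    gcongr
    exact ENNReal.ofReal_toReal_le
  have hi2 : Integrable (fun z => r z ^ 2) ρ := by
    refine (lintegral_ofReal_ne_top_iff_integrable (hrm.pow_const 2).aestronglyMeasurable
      (ae_of_all _ fun z => sq_nonneg _)).1 ?_
    exact (hsq.trans_lt ENNReal.ofReal_lt_top).ne
  have hI2 : ∫ z, r z ^ 2 ∂ρ ≤ A := by
    rw [integral_eq_lintegral_of_nonneg_ae (ae_of_all _ fun z => sq_nonneg _)
      (hrm.pow_const 2).aestronglyMeasurable]
    exact ENNReal.toReal_le_of_le_ofReal hA hsq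
  have hi1 : Integrable r ρ := by
    refine ((integrable_const (1 : ℝ)).add hi2).mono' hrm.aestronglyMeasurable
      (ae_of_all _ fun z => ?_)
    rw [Real.norm_of_nonneg (hr0 z)]
    simp only [Pi.add_apply]
    nlinarith [sq_nonneg (r z - 1)]
  -- The quadratic bound at y = w(r-1), with (r-1)² ≤ r²+1 because r ≥ 0.
  have hlow : ∀ z, w * (r z - 1) - 2 * w ^ 2 * (r z ^ 2 + 1) ≤ Real.log (1 - w + w * r z) := by
    intro z
    have h := sub_two_mul_sq_le_log (y := w * (r z - 1)) (by nlinarith [hr0 z, mul_nonneg hw0 (hr0 z)])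
    have e : 1 + w * (r z - 1) = 1 - w + w * r z := by ring
    rw [e] at h
    refine le_trans ?_ h
    nlinarith [mul_nonneg (sq_nonneg w) (hr0 z)]
  have hil : Integrable (fun z => w * (r z - 1) - 2 * w ^ 2 * (r z ^ 2 + 1)) ρ :=
    ((hi1.sub (integrable_const 1)).const_mul w).sub ((hi2.add (integrable_const 1)).const_mul _)
  have hlog : Integrable (fun z => Real.log (1 - w + w * r z)) ρ := by
    refine ((hil.abs).add (hi1.const_mul w)).mono'
      (Real.measurable_log.comp (by fun_prop)).aestronglyMeasurable (ae_of_all _ fun z => ?_)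
    rw [Real.norm_eq_abs]
    have hup : Real.log (1 - w + w * r z) ≤ w * r z := by
      have := Real.log_le_sub_one_of_pos (x := 1 - w + w * r z)
        (by nlinarith [mul_nonneg hw0 (hr0 z)])
      linarith
    have hwr := mul_nonneg hw0 (hr0 z)
    simp only [Pi.add_apply]
    rw [abs_le]
    refine ⟨?_, ?_⟩
    · have := neg_abs_le (w * (r z - 1) - 2 * w ^ 2 * (r z ^ 2 + 1))
      linarith [hlow z]
    · have := abs_nonneg (w * (r z - 1) - 2 * w ^ 2 * (r z ^ 2 + 1))
      linarith
  refine ⟨hi1, hlog, le_trans ?_ (integral_mono hil hlog hlow)⟩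
  have e : ∫ z, (w * (r z - 1) - 2 * w ^ 2 * (r z ^ 2 + 1)) ∂ρ
      = w * (∫ z, r z ∂ρ - 1) - 2 * w ^ 2 * (∫ z, r z ^ 2 ∂ρ + 1) := by
    have ha : Integrable (fun z => w * (r z - 1)) ρ := (hi1.sub (integrable_const 1)).const_mul w
    have hb : Integrable (fun z => 2 * w ^ 2 * (r z ^ 2 + 1)) ρ :=
      (hi2.add (integrable_const 1)).const_mul _
    rw [integral_sub ha hb, integral_const_mul, integral_const_mul,
      integral_sub hi1 (integrable_const 1), integral_add hi2 (integrable_const 1)]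
    simp
  rw [e]
  have : 2 * w ^ 2 * (∫ z, r z ^ 2 ∂ρ + 1) ≤ 2 * w ^ 2 * (A + 1) := by gcongr
  linarith

/-! ### Deterministic sequences -/

/-- If l < ℓ, the drift is eventually at least δ w n up to summable errors, so divergence of ∑ w
would push j above B. -/
theorem le_limit_of_drift {e j w c : ℕ → ℝ} {l ℓ B : ℝ} (he : Tendsto e atTop (𝓝 l))
    (hw0 : ∀ n, 0 ≤ w n) (hw : ¬ Summable w) (hc0 : ∀ n, 0 ≤ c n) (hc : Summable c)
    (hj : ∀ n, j n + w n * (ℓ - e n) - c n ≤ j (n + 1)) (hB : ∀ n, j n ≤ B) : ℓ ≤ l := by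
  by_contra! hlt
  set δ := (ℓ - l) / 2 with hδ
  have hδ0 : 0 < δ := by rw [hδ]; linarith
  obtain ⟨N, hN⟩ := eventually_atTop.1 (he.eventually (gt_mem_nhds (show l < l + δ by linarith)))
  have key : ∀ n, j N + δ * ∑ i ∈ Finset.range n, w (N + i) - ∑ i ∈ Finset.range n, c (N + i)
      ≤ j (N + n) := by
    intro n
    induction n with
    | zero => simp
    | succ n ih =>
      rw [Finset.sum_range_succ, Finset.sum_range_succ, ← add_assoc]
      have h1 := hj (N + n)
      have h2 : δ * w (N + n) ≤ w (N + n) * (ℓ - e (N + n)) := by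
        rw [mul_comm]
        refine mul_le_mul_of_nonneg_left ?_ (hw0 _)
        have := hN (N + n) (by omega)
        rw [hδ] at this ⊢
        linarith
      linarith
  have hcb : ∀ n, ∑ i ∈ Finset.range n, c (N + i) ≤ ∑' i, c (N + i) := by
    intro n
    have hs : Summable fun i => c (N + i) := by
      simpa [add_comm] using (summable_nat_add_iff N).2 hc
    exact hs.sum_le_tsum _ fun i _ => hc0 _
  apply hw
  rw [← summable_nat_add_iff N]
  refine summable_of_sum_range_le (c := (B - j N + ∑' i, c (N + i)) / δ) (fun n => hw0 _)
    fun n => ?_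
  rw [le_div_iff₀ hδ0]
  have h1 := key n
  have h2 := hcb n
  have h3 := hB (N + n)
  have e1 : ∑ i ∈ Finset.range n, w (i + N) = ∑ i ∈ Finset.range n, w (N + i) :=
    Finset.sum_congr rfl fun i _ => by rw [add_comm]
  rw [e1]
  linarith

/-- Bernoulli's inequality for exponents in [0,1] gives ((n+1)/(n+2))^a ≤ 1 - a/(n+2). By induction
the product of the factors 1 - w_i up to n is at least (n+1)^(-a). -/
theorem rpow_neg_succ_le {a : ℝ} (ha0 : 0 ≤ a) (ha1 : a ≤ 1) (n : ℕ) :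
    ((n : ℝ) + 2) ^ (-a) ≤ (1 - a / ((n : ℝ) + 2)) * ((n : ℝ) + 1) ^ (-a) := by
  have h2 : (0 : ℝ) < n + 2 := by positivity
  have h1 : (0 : ℝ) < n + 1 := by positivity
  have h := rpow_one_add_le_one_add_mul_self (s := -(1 / ((n : ℝ) + 2))) (p := a)
    (by rw [neg_le_neg_iff, div_le_one h2]; linarith [(Nat.cast_nonneg n : (0 : ℝ) ≤ n)]) ha0 ha1
  have e : 1 + -(1 / ((n : ℝ) + 2)) = (n + 1) / (n + 2) := by field_simp; ring
  rw [e] at h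
  have e2 : 1 + a * -(1 / ((n : ℝ) + 2)) = 1 - a / (n + 2) := by ring
  rw [e2] at h
  calc ((n : ℝ) + 2) ^ (-a)
      = (((n : ℝ) + 1) / (n + 2)) ^ a * ((n : ℝ) + 1) ^ (-a) := by
        rw [Real.div_rpow h1.le h2.le, Real.rpow_neg h1.le, Real.rpow_neg h2.le]
        have := (Real.rpow_pos_of_pos h1 a).ne'
        field_simp
    _ ≤ _ := by gcongr

/-- The terms are O(n^(-2+4a)), and 2 - 4a > 1 is exactly a < 1/4. It is applied with p = 4 for the
gain and p = 2 for the log-density. -/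
theorem summable_drift_error {a b : ℝ} (ha0 : 0 ≤ a) (ha : a < 1 / 4) (hb : 0 ≤ b) {p : ℕ}
    (hp : p ≤ 4) :
    Summable fun n : ℕ => 2 * (a / ((n : ℝ) + 2)) ^ 2 * (b / (((n : ℝ) + 1) ^ (-a)) ^ p + 1) := by
  have hs : Summable fun n : ℕ => 1 / (((n + 1 : ℕ) : ℝ)) ^ (2 - 4 * a) :=
    (summable_nat_add_iff 1).2 (Real.summable_one_div_nat_rpow.2 (by linarith))
  refine Summable.of_nonneg_of_le (fun n => by positivity) (fun n => ?_)
    (hs.mul_left (2 * a ^ 2 * (b + 1)))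
  have h1 : (1 : ℝ) ≤ n + 1 := by linarith [(Nat.cast_nonneg n : (0 : ℝ) ≤ n)]
  have h0 : (0 : ℝ) < n + 1 := by linarith
  push_cast
  have hp1 : (1 : ℝ) ≤ (((n : ℝ) + 1) ^ (4 * a)) := Real.one_le_rpow h1 (by linarith)
  have hp2 : 1 / (((n : ℝ) + 1) ^ (-a)) ^ p ≤ ((n : ℝ) + 1) ^ (4 * a) := by
    rw [← Real.rpow_natCast, ← Real.rpow_mul h0.le, one_div, ← Real.rpow_neg h0.le]
    apply Real.rpow_le_rpow_of_exponent_le h1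
    have : (p : ℝ) ≤ 4 := by exact_mod_cast hp
    nlinarith
  have hsplit : 1 / ((n : ℝ) + 1) ^ (2 - 4 * a) = ((n : ℝ) + 1) ^ (4 * a) / ((n : ℝ) + 1) ^ 2 := by
    rw [Real.rpow_sub h0, Real.rpow_ofNat]
    field_simp
  rw [hsplit]
  calc 2 * (a / ((n : ℝ) + 2)) ^ 2 * (b / (((n : ℝ) + 1) ^ (-a)) ^ p + 1)
      ≤ 2 * (a / ((n : ℝ) + 1)) ^ 2 *
        (b * ((n : ℝ) + 1) ^ (4 * a) + ((n : ℝ) + 1) ^ (4 * a)) := by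
        have : b / (((n : ℝ) + 1) ^ (-a)) ^ p ≤ b * ((n : ℝ) + 1) ^ (4 * a) := by
          rw [div_eq_mul_one_div]; gcongr
        gcongr
        linarith
    _ = _ := by field_simp

theorem not_summable_weights {a : ℝ} (ha : 0 < a) :
    ¬ Summable fun n : ℕ => a / ((n : ℝ) + 2) := by
  intro h
  have h2 := h.mul_left a⁻¹
  have h3 : Summable fun n : ℕ => 1 / ((n + 2 : ℕ) : ℝ) := by
    refine h2.congr fun n => ?_
    push_cast
    field_simp
  exact Real.not_summable_one_div_natCast ((summable_nat_add_iff 2).1 h3)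

/-! ### Mixtures and the drift of a single update -/

section Mixture

variable {𝕏 𝕌 : Type*} [MeasurableSpace 𝕏] [MeasurableSpace 𝕌]

/-- The kernel normalised by the mixture density. -/
noncomputable def ratio (k : 𝕏 → 𝕌 → ℝ≥0) (P : Measure 𝕌) (x : 𝕏) (u : 𝕌) : ℝ≥0∞ :=
  (k x u : ℝ≥0∞) / mixture k P x

/-- The correlation of the normalised kernel at two sample points. -/
noncomputable def overlap (k : 𝕏 → 𝕌 → ℝ≥0) (P : Measure 𝕌) (x y : 𝕏) : ℝ≥0∞ :=
  ∫⁻ u, ratio k P x u * ratio k P y u ∂P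

/-- Expected log-likelihood ratio of the mixture `m_P` against `m_{P₀}`, for data with law `M`. -/
noncomputable def gain (k : 𝕏 → 𝕌 → ℝ≥0) (M : Measure 𝕏) (P₀ P : Measure 𝕌) : ℝ :=
  ∫ x, Real.log (mixture k P x / mixture k P₀ x).toReal ∂M

/-- Standing assumptions on a kernel `k`, the law `M` of the data and the initial guess `P₀`. -/
structure RegularKernel (k : 𝕏 → 𝕌 → ℝ≥0) (M : Measure 𝕏) (P₀ : Measure 𝕌) (C : ℝ≥0) : Prop where
  meas : Measurable (Function.uncurry k)
  ne_zero : ∀ᵐ x ∂M, mixture k P₀ x ≠ 0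
  ne_top : ∀ᵐ x ∂M, mixture k P₀ x ≠ ∞
  sq_le : ∀ u, ∫⁻ x, ratio k P₀ x u ^ 2 ∂M ≤ C

/-- A sub-probability measure that dominates a positive multiple of `P₀`. -/
structure Dominating (P₀ P : Measure 𝕌) (c : ℝ) : Prop where
  mass_le : P Set.univ ≤ 1
  pos : 0 < c
  le : ENNReal.ofReal c • P₀ ≤ P

theorem Dominating.isFinite {P₀ P : Measure 𝕌} {c : ℝ} (h : Dominating P₀ P c) :
    IsFiniteMeasure P := ⟨h.mass_le.trans_lt ENNReal.one_lt_top⟩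

theorem measurable_kernel_left {k : 𝕏 → 𝕌 → ℝ≥0} (hk : Measurable (Function.uncurry k)) (x : 𝕏) :
    Measurable fun u => (k x u : ℝ≥0∞) :=
  (hk.comp measurable_prodMk_left).coe_nnreal_ennreal

theorem measurable_mixture {k : 𝕏 → 𝕌 → ℝ≥0} (hk : Measurable (Function.uncurry k))
    (P : Measure 𝕌) [SFinite P] : Measurable (mixture k P) :=
  Measurable.lintegral_prod_right' (f := fun z : 𝕏 × 𝕌 => (k z.1 z.2 : ℝ≥0∞))
    hk.coe_nnreal_ennreal

theorem measurable_ratio {k : 𝕏 → 𝕌 → ℝ≥0} (hk : Measurable (Function.uncurry k))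
    (P : Measure 𝕌) [SFinite P] : Measurable fun z : 𝕏 × 𝕌 => ratio k P z.1 z.2 :=
  hk.coe_nnreal_ennreal.div ((measurable_mixture hk P).comp measurable_fst)

theorem measurable_overlap {k : 𝕏 → 𝕌 → ℝ≥0} (hk : Measurable (Function.uncurry k))
    (P : Measure 𝕌) [SFinite P] : Measurable fun z : 𝕏 × 𝕏 => overlap k P z.1 z.2 := by
  have hr := measurable_ratio hk P
  refine Measurable.lintegral_prod_right'
    (f := fun z : (𝕏 × 𝕏) × 𝕌 => ratio k P z.1.1 z.2 * ratio k P z.1.2 z.2) ?_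
  exact (hr.comp (by fun_prop : Measurable fun z : (𝕏 × 𝕏) × 𝕌 => (z.1.1, z.2))).mul
    (hr.comp (by fun_prop : Measurable fun z : (𝕏 × 𝕏) × 𝕌 => (z.1.2, z.2)))

theorem lintegral_ratio {k : 𝕏 → 𝕌 → ℝ≥0} (hk : Measurable (Function.uncurry k))
    (P Q : Measure 𝕌) (x : 𝕏) : ∫⁻ u, ratio k P x u ∂Q = mixture k Q x / mixture k P x := by
  simp only [ratio, div_eq_mul_inv]
  rw [lintegral_mul_const _ (measurable_kernel_left hk x)]
  rfl

theorem smul_mixture_le {k : 𝕏 → 𝕌 → ℝ≥0} {P₀ P : Measure 𝕌} {c : ℝ≥0∞} (h : c • P₀ ≤ P) (x : 𝕏) :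
    c * mixture k P₀ x ≤ mixture k P x := by
  have := lintegral_mono' h (le_refl fun u => (k x u : ℝ≥0∞))
  rwa [lintegral_smul_measure] at this

/-- An update acts on the mixture density as a multiplicative factor, which logarithms turn into an
additive increment. Cancelling m_P(x) is legitimate only where it is neither 0 nor ∞. -/
theorem mixture_update {k : 𝕏 → 𝕌 → ℝ≥0} (hk : Measurable (Function.uncurry k))
    (P : Measure 𝕌) (w : ℝ) {x : 𝕏} (y : 𝕏) (h0 : mixture k P x ≠ 0) (ht : mixture k P x ≠ ∞) :
    mixture k (update k w y P) x =
      mixture k P x * (ENNReal.ofReal (1 - w) + ENNReal.ofReal w * overlap k P x y) := by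
  have hky := measurable_kernel_left hk y
  have hkx := measurable_kernel_left hk x
  have e : mixture k P x * overlap k P x y =
      ∫⁻ u, (k x u : ℝ≥0∞) ∂(P.withDensity fun u => (k y u : ℝ≥0∞) / mixture k P y) := by
    rw [lintegral_withDensity_eq_lintegral_mul _ (hky.div_const _) hkx, overlap,
      ← lintegral_const_mul]
    · refine lintegral_congr fun u => ?_
      simp only [ratio, Pi.mul_apply]
      rw [← mul_assoc, ENNReal.mul_div_cancel h0 ht, mul_comm]
    · exact (hkx.div_const _).mul (hky.div_const _)
  rw [mixture, update, lintegral_add_measure, lintegral_smul_measure, lintegral_smul_measure, ← e,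
    mul_add]
  simp only [smul_eq_mul, mixture]
  ring

/-! ### Moment bounds and one-step drift inequalities -/

variable {k : 𝕏 → 𝕌 → ℝ≥0} {M : Measure 𝕏} [IsProbabilityMeasure M] {P₀ : Measure 𝕌}
  [IsProbabilityMeasure P₀] {C : ℝ≥0}

/-- Tonelli and t ≤ t² + 1. Positivity of m_0 is not assumed, because this bound is later used to
derive it. -/
theorem lintegral_mixture_div_le (hk : Measurable (Function.uncurry k))
    (hsq : ∀ u, ∫⁻ x, ratio k P₀ x u ^ 2 ∂M ≤ C) {P : Measure 𝕌} (hP : P Set.univ ≤ 1) :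
    ∫⁻ x, mixture k P x / mixture k P₀ x ∂M ≤ C + 1 := by
  have : IsFiniteMeasure P := ⟨hP.trans_lt ENNReal.one_lt_top⟩
  have hr := measurable_ratio hk P₀
  simp_rw [← lintegral_ratio hk]
  rw [lintegral_lintegral_swap hr.aemeasurable]
  calc ∫⁻ u, ∫⁻ x, ratio k P₀ x u ∂M ∂P ≤ ∫⁻ _, ((C : ℝ≥0∞) + 1) ∂P := by
        refine lintegral_mono fun u => ?_
        calc ∫⁻ x, ratio k P₀ x u ∂M ≤ ∫⁻ x, (ratio k P₀ x u ^ 2 + 1) ∂M := by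
              refine lintegral_mono fun x => ?_
              rcases le_total (ratio k P₀ x u) 1 with h | h
              · exact h.trans le_add_self
              · exact (le_self_pow₀ h two_ne_zero).trans le_self_add
          _ ≤ C + 1 := by
              rw [lintegral_add_right _ measurable_const]
              simpa using add_le_add_left (hsq u) 1
    _ ≤ C + 1 := by
        rw [lintegral_const]
        exact mul_le_of_le_one_right' hP

theorem RegularKernel.mixture_ne_top (H : RegularKernel k M P₀ C) {P : Measure 𝕌}
    (hP : P Set.univ ≤ 1) : ∀ᵐ x ∂M, mixture k P x ≠ ∞ := by
  have : IsFiniteMeasure P := ⟨hP.trans_lt ENNReal.one_lt_top⟩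
  have h := ae_lt_top ((measurable_mixture H.meas P).div (measurable_mixture H.meas P₀))
    ((lintegral_mixture_div_le H.meas H.sq_le hP).trans_lt (by finiteness)).ne
  filter_upwards [h, H.ne_top] with x hx hx0 htop
  rw [Pi.div_apply, htop, ENNReal.top_div_of_ne_top hx0] at hx
  exact lt_irrefl _ hx

theorem RegularKernel.mixture_ne_zero (H : RegularKernel k M P₀ C) {P : Measure 𝕌} {c : ℝ}
    (hP : Dominating P₀ P c) : ∀ᵐ x ∂M, mixture k P x ≠ 0 := by
  filter_upwards [H.ne_zero] with x hx h0
  have := smul_mixture_le (k := k) hP.le x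
  rw [h0, nonpos_iff_eq_zero, mul_eq_zero] at this
  rcases this with h | h
  · exact absurd hP.pos (by simpa using h)
  · exact hx h

/-- Domination gives m_P ≥ c m_0, so the ratio grows by at most the factor 1/c. -/
theorem RegularKernel.lintegral_ratio_sq_le (H : RegularKernel k M P₀ C) {P : Measure 𝕌} {c : ℝ}
    (hP : Dominating P₀ P c) (u : 𝕌) :
    ∫⁻ x, ratio k P x u ^ 2 ∂M ≤ ENNReal.ofReal (C / c ^ 2) := by
  have hc := hP.pos
  have hle : ∀ x, ratio k P x u ≤ (ENNReal.ofReal c)⁻¹ * ratio k P₀ x u := by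
    intro x
    rw [ratio, ratio, ENNReal.div_eq_inv_mul, ENNReal.div_eq_inv_mul, ← mul_assoc,
      ← ENNReal.mul_inv (Or.inl (by simpa using hc)) (Or.inl ENNReal.ofReal_ne_top)]
    gcongr
    exact smul_mixture_le hP.le x
  calc ∫⁻ x, ratio k P x u ^ 2 ∂M
      ≤ ∫⁻ x, (ENNReal.ofReal c)⁻¹ ^ 2 * ratio k P₀ x u ^ 2 ∂M := by
        refine lintegral_mono fun x => ?_
        rw [← mul_pow]
        exact pow_le_pow_left' (hle x) 2
    _ = (ENNReal.ofReal c)⁻¹ ^ 2 * ∫⁻ x, ratio k P₀ x u ^ 2 ∂M := by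
        refine lintegral_const_mul' _ _ (ENNReal.pow_ne_top ?_)
        simpa using hc
    _ ≤ (ENNReal.ofReal c)⁻¹ ^ 2 * C := by gcongr; exact H.sq_le u
    _ = ENNReal.ofReal (C / c ^ 2) := by
        rw [← ENNReal.ofReal_inv_of_pos hc, ← ENNReal.ofReal_pow (by positivity),
          ← ENNReal.ofReal_coe_nnreal, ← ENNReal.ofReal_mul (by positivity)]
        congr 1
        field_simp

theorem RegularKernel.integrable_div (H : RegularKernel k M P₀ C) {P : Measure 𝕌}
    (hP : P Set.univ ≤ 1) :
    Integrable (fun x => (mixture k P x / mixture k P₀ x).toReal) M ∧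
      ∫ x, (mixture k P x / mixture k P₀ x).toReal ∂M ≤ C + 1 := by
  have : IsFiniteMeasure P := ⟨hP.trans_lt ENNReal.one_lt_top⟩
  have hm : Measurable fun x => mixture k P x / mixture k P₀ x :=
    (measurable_mixture H.meas P).div (measurable_mixture H.meas P₀)
  have hle := lintegral_mixture_div_le H.meas H.sq_le hP
  have hne := (hle.trans_lt (by finiteness)).ne
  refine ⟨integrable_toReal_of_lintegral_ne_top hm.aemeasurable hne, ?_⟩
  rw [integral_toReal hm.aemeasurable (ae_lt_top hm hne)]
  have := ENNReal.toReal_mono (by finiteness) hle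
  rwa [ENNReal.toReal_add (by simp) (by simp), ENNReal.coe_toReal, ENNReal.toReal_one] at this

/-- The integrand lies between log c and m_P/m_0, since log t ≤ t; both bounds are integrable. -/
theorem RegularKernel.integrable_log (H : RegularKernel k M P₀ C) {P : Measure 𝕌} {c : ℝ}
    (hP : Dominating P₀ P c) :
    Integrable (fun x => Real.log (mixture k P x / mixture k P₀ x).toReal) M ∧
      Real.log c ≤ gain k M P₀ P := by
  have := hP.isFinite
  have hlow : ∀ᵐ x ∂M, Real.log c ≤ Real.log (mixture k P x / mixture k P₀ x).toReal := by
    filter_upwards [H.ne_zero, H.ne_top, H.mixture_ne_top hP.mass_le] with x h0 h1 h2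
    apply Real.log_le_log hP.pos
    rw [← ENNReal.ofReal_le_iff_le_toReal (ENNReal.div_ne_top h2 h0),
      ENNReal.le_div_iff_mul_le (Or.inl h0) (Or.inl h1)]
    exact smul_mixture_le hP.le x
  have hi : Integrable (fun x => Real.log (mixture k P x / mixture k P₀ x).toReal) M := by
    refine ((H.integrable_div hP.mass_le).1.add (integrable_const |Real.log c|)).mono'
      (Real.measurable_log.comp (((measurable_mixture H.meas P).div
        (measurable_mixture H.meas P₀)).ennreal_toReal)).aestronglyMeasurable ?_
    filter_upwards [hlow] with x hx
    rw [Real.norm_eq_abs, abs_le]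
    simp only [Pi.add_apply]
    set t := (mixture k P x / mixture k P₀ x).toReal
    have ht : 0 ≤ t := ENNReal.toReal_nonneg
    have h1 := Real.log_le_self ht
    exact ⟨by linarith [neg_abs_le (Real.log c)], by linarith [abs_nonneg (Real.log c)]⟩
  refine ⟨hi, ?_⟩
  have := integral_mono_ae (integrable_const (Real.log c)) hi hlow
  rwa [integral_const, probReal_univ, one_smul] at this

theorem RegularKernel.gain_le (H : RegularKernel k M P₀ C) {P : Measure 𝕌} {c : ℝ}
    (hP : Dominating P₀ P c) : gain k M P₀ P ≤ C + 1 :=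
  (integral_mono (H.integrable_log hP).1 (H.integrable_div hP.mass_le).1
    fun _ => Real.log_le_self ENNReal.toReal_nonneg).trans (H.integrable_div hP.mass_le).2

/-- Cauchy–Schwarz in u, after which the integral over the two independent sample points factorises
for each u. -/
theorem RegularKernel.lintegral_overlap_sq_le (H : RegularKernel k M P₀ C) {P : Measure 𝕌} {c : ℝ}
    (hP : Dominating P₀ P c) :
    ∫⁻ z : 𝕏 × 𝕏, overlap k P z.1 z.2 ^ 2 ∂(M.prod M) ≤ ENNReal.ofReal (C ^ 2 / c ^ 4) := by
  have := hP.isFinite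
  have hr := measurable_ratio H.meas P
  have hr' : ∀ u, Measurable fun x => ratio k P x u := fun u =>
    hr.comp (measurable_id.prodMk measurable_const)
  have hr'' : ∀ x, Measurable fun u => ratio k P x u := fun x => hr.comp measurable_prodMk_left
  calc ∫⁻ z : 𝕏 × 𝕏, overlap k P z.1 z.2 ^ 2 ∂(M.prod M)
      ≤ ∫⁻ z : 𝕏 × 𝕏, ∫⁻ u, ratio k P z.1 u ^ 2 * ratio k P z.2 u ^ 2 ∂P ∂(M.prod M) := by
        refine lintegral_mono fun z => ?_
        simp_rw [← mul_pow]
        exact sq_lintegral_le P hP.mass_le ((hr'' _).mul (hr'' _)).aemeasurable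
    _ = ∫⁻ u, ∫⁻ z : 𝕏 × 𝕏, ratio k P z.1 u ^ 2 * ratio k P z.2 u ^ 2 ∂(M.prod M) ∂P := by
        refine lintegral_lintegral_swap (Measurable.aemeasurable ?_)
        exact ((hr.comp (by fun_prop : Measurable fun z : (𝕏 × 𝕏) × 𝕌 => (z.1.1, z.2))).pow_const
          2).mul ((hr.comp (by fun_prop :
            Measurable fun z : (𝕏 × 𝕏) × 𝕌 => (z.1.2, z.2))).pow_const 2)
    _ ≤ ∫⁻ _, ENNReal.ofReal (C / c ^ 2) * ENNReal.ofReal (C / c ^ 2) ∂P := by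
        refine lintegral_mono fun u => ?_
        rw [lintegral_prod_mul (μ := M) (ν := M) ((hr' u).pow_const 2).aemeasurable
          ((hr' u).pow_const 2).aemeasurable]
        gcongr <;> exact H.lintegral_ratio_sq_le hP u
    _ ≤ ENNReal.ofReal (C / c ^ 2) * ENNReal.ofReal (C / c ^ 2) := by
        rw [lintegral_const]
        exact mul_le_of_le_one_right' hP.mass_le
    _ = ENNReal.ofReal (C ^ 2 / c ^ 4) := by
        have := hP.pos
        rw [← ENNReal.ofReal_mul (by positivity)]
        congr 1
        field_simp

/-- By Tonelli the mean overlap is ∫ h² dP with h(u) = ∫ k(x|u)/m_P(x) dM. Here ∫ h dP = 1 because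
m_P/m_P = 1 almost everywhere, so Cauchy–Schwarz applies. This is what makes the recursion ascend on
average. -/
theorem RegularKernel.one_le_lintegral_overlap (H : RegularKernel k M P₀ C) {P : Measure 𝕌} {c : ℝ}
    (hP : Dominating P₀ P c) :
    1 ≤ ∫⁻ z : 𝕏 × 𝕏, overlap k P z.1 z.2 ∂(M.prod M) := by
  have := hP.isFinite
  have hr := measurable_ratio H.meas P
  have hr' : ∀ u, Measurable fun x => ratio k P x u := fun u =>
    hr.comp (measurable_id.prodMk measurable_const)
  have e : ∫⁻ z : 𝕏 × 𝕏, overlap k P z.1 z.2 ∂(M.prod M)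
      = ∫⁻ u, (∫⁻ x, ratio k P x u ∂M) ^ 2 ∂P := by
    unfold overlap
    rw [lintegral_lintegral_swap]
    · refine lintegral_congr fun u => ?_
      rw [lintegral_prod_mul (μ := M) (ν := M) (hr' u).aemeasurable (hr' u).aemeasurable, sq]
    · exact ((hr.comp (by fun_prop : Measurable fun z : (𝕏 × 𝕏) × 𝕌 => (z.1.1, z.2))).mul
        (hr.comp (by fun_prop :
          Measurable fun z : (𝕏 × 𝕏) × 𝕌 => (z.1.2, z.2)))).aemeasurable
  rw [e]
  refine one_le_lintegral_sq P hP.mass_le (Measurable.lintegral_prod_left' hr) ?_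
  rw [← lintegral_lintegral_swap hr.aemeasurable]
  simp_rw [lintegral_ratio H.meas]
  have : ∫⁻ x, mixture k P x / mixture k P x ∂M = 1 := by
    have : ∀ᵐ x ∂M, mixture k P x / mixture k P x = 1 := by
      filter_upwards [H.mixture_ne_zero hP, H.mixture_ne_top hP.mass_le] with x h0 h1
      exact ENNReal.div_self h0 h1
    rw [lintegral_congr_ae this]
    simp
  exact this.ge

theorem RegularKernel.gain_update (H : RegularKernel k M P₀ C) {P : Measure 𝕌} {c : ℝ}
    (hP : Dominating P₀ P c) {w : ℝ} (hw0 : 0 ≤ w) (hw : w ≤ 1 / 2) :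
    ∀ᵐ y ∂M, gain k M P₀ (update k w y P) =
      gain k M P₀ P + ∫ x, Real.log (1 - w + w * (overlap k P x y).toReal) ∂M := by
  have := hP.isFinite
  have hc := hP.pos
  have hswap : Measurable fun z : 𝕏 × 𝕏 => overlap k P z.2 z.1 :=
    (measurable_overlap H.meas P).comp measurable_swap
  have hsq : ∫⁻ z : 𝕏 × 𝕏, overlap k P z.2 z.1 ^ 2 ∂(M.prod M) ≤ ENNReal.ofReal (C ^ 2 / c ^ 4) := by
    refine le_trans (le_of_eq ?_) (H.lintegral_overlap_sq_le hP)
    exact lintegral_prod_swap (fun z : 𝕏 × 𝕏 => overlap k P z.1 z.2 ^ 2)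
  obtain ⟨-, hlog, -⟩ := le_integral_log_mix (M.prod M) (g := fun z => overlap k P z.2 z.1) hswap
    (by positivity) hsq hw0 hw
  have hfin : ∀ᵐ z ∂(M.prod M), overlap k P z.2 z.1 ≠ ∞ := by
    have := ae_lt_top (hswap.pow_const 2) (hsq.trans_lt ENNReal.ofReal_lt_top).ne
    filter_upwards [this] with z hz h
    simp [h] at hz
  filter_upwards [hlog.prod_right_ae, Measure.ae_ae_of_ae_prod hfin] with y hy hyfin
  rw [gain, gain, ← integral_add (H.integrable_log hP).1 hy]
  refine integral_congr_ae ?_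
  filter_upwards [H.ne_zero, H.ne_top, H.mixture_ne_zero hP, H.mixture_ne_top hP.mass_le, hyfin]
    with x h0 h1 h2 h3 h4
  rw [mixture_update H.meas P w y h2 h3, ENNReal.mul_div_right_comm, ENNReal.toReal_mul,
    Real.log_mul]
  · congr 2
    rw [ENNReal.toReal_add ENNReal.ofReal_ne_top (ENNReal.mul_ne_top ENNReal.ofReal_ne_top h4),
      ENNReal.toReal_mul, ENNReal.toReal_ofReal (by linarith), ENNReal.toReal_ofReal hw0]
  · exact (ENNReal.toReal_pos (ENNReal.div_ne_zero.2 ⟨h2, h1⟩) (ENNReal.div_ne_top h3 h0)).ne'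
  · refine (ENNReal.toReal_pos ?_ ?_).ne'
    · have : ENNReal.ofReal (1 - w) ≠ 0 := by
        rw [Ne, ENNReal.ofReal_eq_zero]; linarith
      simp [this]
    · exact ENNReal.add_ne_top.2
        ⟨ENNReal.ofReal_ne_top, ENNReal.mul_ne_top ENNReal.ofReal_ne_top h4⟩

/-- On average, one update decreases the expected log-likelihood by at most a second order term. -/
theorem RegularKernel.gain_drift (H : RegularKernel k M P₀ C) {P : Measure 𝕌} {c : ℝ}
    (hP : Dominating P₀ P c) {w : ℝ} (hw0 : 0 ≤ w) (hw : w ≤ 1 / 2) :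
    gain k M P₀ P - 2 * w ^ 2 * (C ^ 2 / c ^ 4 + 1) ≤ ∫ y, gain k M P₀ (update k w y P) ∂M := by
  have := hP.isFinite
  have hc := hP.pos
  have hswap : Measurable fun z : 𝕏 × 𝕏 => overlap k P z.2 z.1 :=
    (measurable_overlap H.meas P).comp measurable_swap
  have hsq : ∫⁻ z : 𝕏 × 𝕏, overlap k P z.2 z.1 ^ 2 ∂(M.prod M) ≤ ENNReal.ofReal (C ^ 2 / c ^ 4) := by
    refine le_trans (le_of_eq ?_) (H.lintegral_overlap_sq_le hP)
    exact lintegral_prod_swap (fun z : 𝕏 × 𝕏 => overlap k P z.1 z.2 ^ 2)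
  obtain ⟨hint, hlog, hle⟩ := le_integral_log_mix (M.prod M) (g := fun z => overlap k P z.2 z.1)
    hswap (by positivity) hsq hw0 hw
  rw [integral_congr_ae (H.gain_update hP hw0 hw),
    integral_add (integrable_const _) hlog.integral_prod_left,
    ← integral_prod (fun z : 𝕏 × 𝕏 => Real.log (1 - w + w * (overlap k P z.2 z.1).toReal)) hlog]
  -- The first-order coefficient is nonnegative, so only the second-order error survives.
  have h1 : 1 ≤ ∫ z : 𝕏 × 𝕏, (overlap k P z.2 z.1).toReal ∂(M.prod M) := by
    have hsw : ∫⁻ z : 𝕏 × 𝕏, overlap k P z.2 z.1 ∂(M.prod M) =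
        ∫⁻ z : 𝕏 × 𝕏, overlap k P z.1 z.2 ∂(M.prod M) :=
      lintegral_prod_swap (fun z : 𝕏 × 𝕏 => overlap k P z.1 z.2)
    have hsq' : ∫⁻ z : 𝕏 × 𝕏, overlap k P z.2 z.1 ∂(M.prod M) ≠ ∞ := by
      intro h
      have h3 := (sq_lintegral_le (M.prod M) (by simp) hswap.aemeasurable).trans hsq
      rw [h] at h3
      simp at h3
    rw [integral_toReal hswap.aemeasurable (ae_lt_top hswap hsq')]
    have := ENNReal.toReal_mono hsq' (hsw ▸ H.one_le_lintegral_overlap hP)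
    simpa using this
  simp only [integral_const, probReal_univ, one_smul]
  have := mul_nonneg hw0 (sub_nonneg.2 h1)
  linarith

/-- Average increase of the log-density of the mixing distribution, integrated against `Q`. -/
theorem RegularKernel.ratio_drift (H : RegularKernel k M P₀ C) {P Q : Measure 𝕌} {c : ℝ}
    (hP : Dominating P₀ P c) [IsProbabilityMeasure Q] {c' : ℝ} (hQ : Dominating P₀ Q c') {w : ℝ}
    (hw0 : 0 ≤ w) (hw : w ≤ 1 / 2) :
    (∀ᵐ y ∂M, Integrable (fun u => Real.log (1 - w + w * (ratio k P y u).toReal)) Q) ∧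
    Integrable (fun y => ∫ u, Real.log (1 - w + w * (ratio k P y u).toReal) ∂Q) M ∧
    w * (gain k M P₀ Q - gain k M P₀ P) - 2 * w ^ 2 * (C / c ^ 2 + 1) ≤
      ∫ y, ∫ u, Real.log (1 - w + w * (ratio k P y u).toReal) ∂Q ∂M := by
  have := hP.isFinite
  have hc := hP.pos
  have hr := measurable_ratio H.meas P
  have hsq : ∫⁻ z : 𝕏 × 𝕌, ratio k P z.1 z.2 ^ 2 ∂(M.prod Q) ≤ ENNReal.ofReal (C / c ^ 2) := by
    rw [lintegral_prod_symm _ (hr.pow_const 2).aemeasurable]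
    refine (lintegral_mono fun u => H.lintegral_ratio_sq_le hP u).trans ?_
    simp
  obtain ⟨hint, hlog, hle⟩ := le_integral_log_mix (M.prod Q) (g := fun z => ratio k P z.1 z.2) hr
    (by positivity) hsq hw0 hw
  refine ⟨hlog.prod_right_ae, hlog.integral_prod_left, ?_⟩
  rw [← integral_prod (fun z : 𝕏 × 𝕌 => Real.log (1 - w + w * (ratio k P z.1 z.2).toReal)) hlog]
  refine le_trans ?_ hle
  have hne : ∫⁻ z : 𝕏 × 𝕌, ratio k P z.1 z.2 ∂(M.prod Q) ≠ ∞ := by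
    intro h
    have h3 := (sq_lintegral_le (M.prod Q) (by simp) hr.aemeasurable).trans hsq
    rw [h] at h3
    simp at h3
  have hne' : ∀ᵐ y ∂M, mixture k Q y / mixture k P y < ∞ := by
    rw [lintegral_prod _ hr.aemeasurable] at hne
    simp_rw [lintegral_ratio H.meas] at hne
    exact ae_lt_top ((measurable_mixture H.meas Q).div (measurable_mixture H.meas P)) hne
  have hinner : ∀ᵐ y ∂M, ∫ u, (ratio k P y u).toReal ∂Q =
      (mixture k Q y / mixture k P y).toReal := by
    filter_upwards [hne'] with y hy
    have hm : Measurable fun u => ratio k P y u := hr.comp measurable_prodMk_left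
    rw [← lintegral_ratio H.meas] at hy ⊢
    rw [integral_toReal hm.aemeasurable (ae_lt_top hm hy.ne)]
  have hQi := (H.integrable_log hQ).1
  have hPi := (H.integrable_log hP).1
  -- Pointwise log(m_Q/m_P) ≤ m_Q/m_P - 1, and the mean of m_Q/m_P is the mean of the ratio under M
  -- ⊗ Q.
  have h1 : gain k M P₀ Q - gain k M P₀ P ≤
      ∫ z : 𝕏 × 𝕌, (ratio k P z.1 z.2).toReal ∂(M.prod Q) - 1 := by
    rw [integral_prod _ hint, gain, gain, ← integral_sub hQi hPi, integral_congr_ae hinner]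
    have hD : Integrable (fun y => (mixture k Q y / mixture k P y).toReal) M :=
      hint.integral_prod_left.congr hinner
    have : ∫ y, ((mixture k Q y / mixture k P y).toReal - 1) ∂M =
        ∫ y, (mixture k Q y / mixture k P y).toReal ∂M - 1 := by
      rw [integral_sub hD (integrable_const 1)]; simp
    rw [← this]
    refine integral_mono_ae (hQi.sub hPi) (hD.sub (integrable_const 1)) ?_
    filter_upwards [H.ne_zero, H.ne_top, H.mixture_ne_zero hP, H.mixture_ne_top hP.mass_le,
      H.mixture_ne_zero hQ, H.mixture_ne_top hQ.mass_le] with y a1 a2 b1 b2 d1 d2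
    simp only [ENNReal.toReal_div]
    have a := ENNReal.toReal_pos a1 a2
    have b := ENNReal.toReal_pos b1 b2
    have d := ENNReal.toReal_pos d1 d2
    rw [Real.log_div d.ne' a.ne', Real.log_div b.ne' a.ne']
    have := Real.log_le_sub_one_of_pos (div_pos d b)
    rw [Real.log_div d.ne' b.ne'] at this
    linarith
  have := mul_le_mul_of_nonneg_left h1 hw0
  linarith

end Mixture

/-! ### The recursion as a density process -/

section Recursion

variable {𝕏 𝕌 : Type*} [MeasurableSpace 𝕏] [MeasurableSpace 𝕌]

/-- The density of the `n`-th estimate with respect to the initial guess. -/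
noncomputable def dens (k : 𝕏 → 𝕌 → ℝ≥0) (w : ℕ → ℝ) (P₀ : Measure 𝕌) (x : ℕ → 𝕏) :
    ℕ → 𝕌 → ℝ≥0∞
  | 0 => fun _ => 1
  | n + 1 => fun u => dens k w P₀ x n u * (ENNReal.ofReal (1 - w (n + 1)) +
      ENNReal.ofReal (w (n + 1)) * ratio k (P₀.withDensity (dens k w P₀ x n)) (x (n + 1)) u)

variable {k : 𝕏 → 𝕌 → ℝ≥0} {w : ℕ → ℝ} {P₀ : Measure 𝕌} [IsProbabilityMeasure P₀]

/-- Densities with respect to the fixed P_0 reduce measurability in the data to joint measurability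
of functions, with no measurable families of measures. -/
theorem measurable_mixture_withDensity {Z : Type*} [MeasurableSpace Z]
    (hk : Measurable (Function.uncurry k)) {f : Z → 𝕌 → ℝ≥0∞}
    (hf : Measurable (Function.uncurry f)) :
    Measurable fun z : Z × 𝕏 => mixture k (P₀.withDensity (f z.1)) z.2 := by
  have e : ∀ z : Z × 𝕏, mixture k (P₀.withDensity (f z.1)) z.2 =
      ∫⁻ u, f z.1 u * (k z.2 u : ℝ≥0∞) ∂P₀ := by
    intro z
    have hfz : Measurable (f z.1) := hf.comp measurable_prodMk_left
    rw [mixture, lintegral_withDensity_eq_lintegral_mul _ hfz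
      (measurable_kernel_left hk _)]
    rfl
  simp_rw [e]
  refine Measurable.lintegral_prod_right'
    (f := fun z : (Z × 𝕏) × 𝕌 => f z.1.1 z.2 * (k z.1.2 z.2 : ℝ≥0∞)) ?_
  exact (hf.comp (by fun_prop : Measurable fun z : (Z × 𝕏) × 𝕌 => (z.1.1, z.2))).mul
    (hk.coe_nnreal_ennreal.comp (by fun_prop : Measurable fun z : (Z × 𝕏) × 𝕌 => (z.1.2, z.2)))

theorem measurable_mul_update {Z : Type*} [MeasurableSpace Z]
    (hk : Measurable (Function.uncurry k)) {f : Z → 𝕌 → ℝ≥0∞}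
    (hf : Measurable (Function.uncurry f)) {g : Z → 𝕏} (hg : Measurable g) (A B : ℝ≥0∞) :
    Measurable (Function.uncurry fun z u =>
      f z u * (A + B * ratio k (P₀.withDensity (f z)) (g z) u)) := by
  have hm : Measurable fun z : Z × 𝕌 => mixture k (P₀.withDensity (f z.1)) (g z.1) := by
    have h1 : Measurable fun z : Z × 𝕌 => (z.1, g z.1) :=
      measurable_fst.prodMk (hg.comp measurable_fst)
    have h2 := measurable_mixture_withDensity (P₀ := P₀) hk hf
    simpa only [Function.comp_def] using h2.comp h1
  have hkz : Measurable fun z : Z × 𝕌 => (k (g z.1) z.2 : ℝ≥0∞) :=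
    (hk.comp ((hg.comp measurable_fst).prodMk measurable_snd)).coe_nnreal_ennreal
  exact hf.mul (((hkz.div hm).const_mul _).const_add _)

theorem measurable_dens (hk : Measurable (Function.uncurry k)) (n : ℕ) :
    Measurable (Function.uncurry fun x => dens k w P₀ x n) := by
  induction n with
  | zero => exact measurable_const
  | succ n ih => exact measurable_mul_update hk ih (measurable_pi_apply (n + 1)) _ _

theorem measurable_dens_left (hk : Measurable (Function.uncurry k)) (x : ℕ → 𝕏) (n : ℕ) :
    Measurable (dens k w P₀ x n) :=
  (measurable_dens hk n).comp measurable_prodMk_left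

theorem estimate_eq_withDensity (hk : Measurable (Function.uncurry k)) (x : ℕ → 𝕏) (n : ℕ) :
    estimate k w P₀ x n = P₀.withDensity (dens k w P₀ x n) := by
  induction n with
  | zero => simp only [estimate, dens]; exact withDensity_one.symm
  | succ n ih =>
    have hd := measurable_dens_left (w := w) (P₀ := P₀) hk x n
    have hr : Measurable fun u => ratio k (P₀.withDensity (dens k w P₀ x n)) (x (n + 1)) u :=
      (measurable_kernel_left hk _).div_const _
    have e : dens k w P₀ x (n + 1) = dens k w P₀ x n *
        ((fun _ => ENNReal.ofReal (1 - w (n + 1))) + ENNReal.ofReal (w (n + 1)) •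
          fun u => ratio k (P₀.withDensity (dens k w P₀ x n)) (x (n + 1)) u) := rfl
    rw [estimate, ih, e, withDensity_mul _ hd (measurable_const.add (hr.const_smul _)),
      withDensity_add_left measurable_const, withDensity_const, withDensity_smul _ hr]
    rfl

theorem estimate_congr {x y : ℕ → 𝕏} {n : ℕ} (h : ∀ i ≤ n, x i = y i) :
    estimate k w P₀ x n = estimate k w P₀ y n := by
  induction n with
  | zero => rfl
  | succ n ih => rw [estimate, estimate, ih fun i hi => h i (by omega), h (n + 1) le_rfl]

theorem dens_congr {x y : ℕ → 𝕏} {n : ℕ} (h : ∀ i ≤ n, x i = y i) :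
    dens k w P₀ x n = dens k w P₀ y n := by
  induction n with
  | zero => rfl
  | succ n ih => rw [dens, dens, ih fun i hi => h i (by omega), h (n + 1) le_rfl]

/-- Integrating over the replaced coordinate y under M plays the role of the conditional expectation
given the first n observations. -/
theorem estimate_update (x : ℕ → 𝕏) (n : ℕ) (y : 𝕏) :
    estimate k w P₀ (Function.update x (n + 1) y) (n + 1) =
      update k (w (n + 1)) y (estimate k w P₀ x n) := by
  rw [estimate, Function.update_self, estimate_congr (y := x) fun i hi =>
    Function.update_of_ne (by omega) _ _]

theorem dens_update (x : ℕ → 𝕏) (n : ℕ) (y : 𝕏) (u : 𝕌) :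
    dens k w P₀ (Function.update x (n + 1) y) (n + 1) u =
      dens k w P₀ x n u * (ENNReal.ofReal (1 - w (n + 1)) +
        ENNReal.ofReal (w (n + 1)) * ratio k (P₀.withDensity (dens k w P₀ x n)) y u) := by
  rw [dens, Function.update_self, dens_congr (y := x) fun i hi =>
    Function.update_of_ne (by omega) _ _]

theorem update_univ (hk : Measurable (Function.uncurry k)) (P : Measure 𝕌) (v : ℝ) (y : 𝕏) :
    update k v y P Set.univ = ENNReal.ofReal (1 - v) * P Set.univ +
      ENNReal.ofReal v * (mixture k P y / mixture k P y) := by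
  simp only [update, Measure.coe_add, Measure.coe_smul, Pi.add_apply, Pi.smul_apply, smul_eq_mul,
    withDensity_apply _ MeasurableSet.univ, Measure.restrict_univ]
  rw [← lintegral_ratio hk]
  rfl

/-- The reweighted part is nonnegative and may be dropped for the lower bound. Its mass
m_P(y)/m_P(y) is at most 1 even in the degenerate cases 0 and ∞, so the bounds hold for every data
sequence. -/
theorem Dominating.update (hk : Measurable (Function.uncurry k)) {P : Measure 𝕌} {c : ℝ}
    (hP : Dominating P₀ P c) {v : ℝ} (hv0 : 0 ≤ v) (hv : v < 1) (y : 𝕏) :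
    Dominating P₀ (update k v y P) ((1 - v) * c) where
  mass_le := by
    rw [update_univ hk]
    calc _ ≤ ENNReal.ofReal (1 - v) * 1 + ENNReal.ofReal v * 1 := by
          gcongr
          · exact hP.mass_le
          · exact ENNReal.div_self_le_one
      _ = 1 := by
          rw [mul_one, mul_one, ← ENNReal.ofReal_add (by linarith) hv0]
          simp
  pos := mul_pos (by linarith) hP.pos
  le := by
    rw [ENNReal.ofReal_mul (by linarith), mul_smul]
    refine le_trans ?_ (Measure.le_add_right le_rfl)
    exact Measure.le_iff.2 fun s _ => by
      simpa using mul_le_mul_right (hP.le s) _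

theorem Dominating.mono {P : Measure 𝕌} {c d : ℝ} (hP : Dominating P₀ P c) (hd : 0 < d)
    (hdc : d ≤ c) : Dominating P₀ P d where
  mass_le := hP.mass_le
  pos := hd
  le := by
    refine le_trans (Measure.le_iff.2 fun s _ => ?_) hP.le
    simp only [Measure.coe_smul, Pi.smul_apply, smul_eq_mul]
    gcongr

theorem dominating_estimate (hk : Measurable (Function.uncurry k)) {a : ℝ} (ha0 : 0 < a)
    (ha : a < 1 / 4) (hw : ∀ n : ℕ, w (n + 1) = a / ((n : ℝ) + 2)) (x : ℕ → 𝕏) (n : ℕ) :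
    Dominating P₀ (estimate k w P₀ x n) (((n : ℝ) + 1) ^ (-a)) := by
  induction n with
  | zero => exact ⟨by simp [estimate], by simp, by simp [estimate]⟩
  | succ n ih =>
    have h2 : (0 : ℝ) < n + 2 := by positivity
    have hlt : w (n + 1) < 1 := by
      rw [hw, div_lt_one h2]; linarith [(Nat.cast_nonneg n : (0 : ℝ) ≤ n)]
    have h := ih.update hk (v := w (n + 1)) (by rw [hw]; positivity) hlt (x (n + 1))
    refine h.mono (by positivity) ?_
    rw [hw]
    have := rpow_neg_succ_le ha0.le (by linarith) n
    push_cast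
    rwa [add_assoc, one_add_one_eq_two]

theorem le_dens {a : ℝ} (ha0 : 0 < a)
    (ha : a < 1 / 4) (hw : ∀ n : ℕ, w (n + 1) = a / ((n : ℝ) + 2)) (x : ℕ → 𝕏) (n : ℕ) (u : 𝕌) :
    ENNReal.ofReal (((n : ℝ) + 1) ^ (-a)) ≤ dens k w P₀ x n u := by
  induction n with
  | zero => simp [dens]
  | succ n ih =>
    have h2 : (0 : ℝ) < n + 2 := by positivity
    have hlt : w (n + 1) < 1 := by
      rw [hw, div_lt_one h2]; linarith [(Nat.cast_nonneg n : (0 : ℝ) ≤ n)]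
    have := rpow_neg_succ_le ha0.le (by linarith) n
    calc ENNReal.ofReal ((((n + 1 : ℕ) : ℝ) + 1) ^ (-a))
        ≤ ENNReal.ofReal (((n : ℝ) + 1) ^ (-a) * (1 - w (n + 1))) := by
          apply ENNReal.ofReal_le_ofReal
          push_cast
          rw [add_assoc, one_add_one_eq_two, hw]
          linarith
      _ = ENNReal.ofReal (((n : ℝ) + 1) ^ (-a)) * ENNReal.ofReal (1 - w (n + 1)) :=
          ENNReal.ofReal_mul (by positivity)
      _ ≤ _ := by
          rw [dens]
          exact mul_le_mul' ih le_self_add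

/-! ### Drift of the log-likelihood and of the log-density along the recursion -/

/-- Log-density of the `n`-th estimate, integrated against `Q`. -/
noncomputable def logDens (k : 𝕏 → 𝕌 → ℝ≥0) (w : ℕ → ℝ) (P₀ Q : Measure 𝕌) (n : ℕ)
    (x : ℕ → 𝕏) : ℝ :=
  ∫ u, Real.log (dens k w P₀ x n u).toReal ∂Q

variable {M : Measure 𝕏} [IsProbabilityMeasure M] {C : ℝ≥0} {a : ℝ}

theorem measurable_gain (hk : Measurable (Function.uncurry k)) (n : ℕ) :
    Measurable fun x : ℕ → 𝕏 => gain k M P₀ (estimate k w P₀ x n) := by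
  simp_rw [estimate_eq_withDensity hk]
  refine StronglyMeasurable.measurable (StronglyMeasurable.integral_prod_right'
    (f := fun z : (ℕ → 𝕏) × 𝕏 => Real.log (mixture k (P₀.withDensity (dens k w P₀ z.1 n)) z.2 /
      mixture k P₀ z.2).toReal) (Measurable.stronglyMeasurable ?_))
  exact Real.measurable_log.comp ((measurable_mixture_withDensity hk (measurable_dens hk n)).div
    ((measurable_mixture hk P₀).comp measurable_snd)).ennreal_toReal

theorem measurable_logDens (hk : Measurable (Function.uncurry k)) (Q : Measure 𝕌) [SFinite Q]
    (n : ℕ) : Measurable (logDens k w P₀ Q n) := by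
  refine StronglyMeasurable.measurable (StronglyMeasurable.integral_prod_right'
    (f := fun z : (ℕ → 𝕏) × 𝕌 => Real.log (dens k w P₀ z.1 n z.2).toReal)
    (Measurable.stronglyMeasurable ?_))
  exact Real.measurable_log.comp (measurable_dens hk n).ennreal_toReal

theorem RegularKernel.gain_estimate_drift (H : RegularKernel k M P₀ C) (ha0 : 0 < a)
    (ha : a < 1 / 4) (hw : ∀ n : ℕ, w (n + 1) = a / ((n : ℝ) + 2)) (n : ℕ) (x : ℕ → 𝕏) :
    gain k M P₀ (estimate k w P₀ x n) -
        2 * (a / ((n : ℝ) + 2)) ^ 2 * (C ^ 2 / (((n : ℝ) + 1) ^ (-a)) ^ 4 + 1) ≤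
      ∫ y, gain k M P₀ (estimate k w P₀ (Function.update x (n + 1) y) (n + 1)) ∂M := by
  simp_rw [estimate_update]
  have h2 : (0 : ℝ) < n + 2 := by positivity
  have hle : w (n + 1) ≤ 1 / 2 := by
    rw [hw, div_le_iff₀ h2]; linarith [(Nat.cast_nonneg n : (0 : ℝ) ≤ n)]
  have := H.gain_drift (dominating_estimate H.meas ha0 ha hw x n)
    (w := w (n + 1)) (by rw [hw]; positivity) hle
  rwa [← hw]

/-- The upper bound uses the bounded density of Q: ∫ log d dQ ≤ ∫ d dQ ≤ B ∫ d dP_0 ≤ B. The lower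
bound is the pointwise `le_dens`. -/
theorem integrable_log_dens (hk : Measurable (Function.uncurry k)) (ha0 : 0 < a)
    (ha : a < 1 / 4) (hw : ∀ n : ℕ, w (n + 1) = a / ((n : ℝ) + 2)) {Q : Measure 𝕌}
    [IsProbabilityMeasure Q] {B : ℝ≥0} (hQ : Q ≤ (B : ℝ≥0∞) • P₀) (n : ℕ) (x : ℕ → 𝕏) :
    (∀ᵐ u ∂Q, dens k w P₀ x n u ≠ ∞) ∧
    Integrable (fun u => Real.log (dens k w P₀ x n u).toReal) Q ∧
    Real.log (((n : ℝ) + 1) ^ (-a)) ≤ logDens k w P₀ Q n x ∧ logDens k w P₀ Q n x ≤ B := by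
  have hd := measurable_dens_left (w := w) (P₀ := P₀) hk x n
  have hmass : ∫⁻ u, dens k w P₀ x n u ∂P₀ ≤ 1 := by
    have := (dominating_estimate (P₀ := P₀) hk ha0 ha hw x n).mass_le
    rwa [estimate_eq_withDensity hk, withDensity_apply _ MeasurableSet.univ,
      Measure.restrict_univ] at this
  have hQmass : ∫⁻ u, dens k w P₀ x n u ∂Q ≤ B := by
    calc _ ≤ ∫⁻ u, dens k w P₀ x n u ∂((B : ℝ≥0∞) • P₀) := lintegral_mono' hQ le_rfl
      _ = B * ∫⁻ u, dens k w P₀ x n u ∂P₀ := by rw [lintegral_smul_measure]; rfl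
      _ ≤ B := mul_le_of_le_one_right' hmass
  have hne := (hQmass.trans_lt ENNReal.coe_lt_top).ne
  have hfin := ae_lt_top hd hne
  have hint := integrable_toReal_of_lintegral_ne_top hd.aemeasurable hne
  have hup : ∫ u, (dens k w P₀ x n u).toReal ∂Q ≤ B := by
    rw [integral_toReal hd.aemeasurable hfin]
    exact ENNReal.toReal_le_coe_of_le_coe hQmass
  have hlow : ∀ᵐ u ∂Q, Real.log (((n : ℝ) + 1) ^ (-a)) ≤ Real.log (dens k w P₀ x n u).toReal := by
    filter_upwards [hfin] with u hu
    apply Real.log_le_log (by positivity)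
    rw [← ENNReal.ofReal_le_iff_le_toReal hu.ne]
    exact le_dens ha0 ha hw x n u
  have hi : Integrable (fun u => Real.log (dens k w P₀ x n u).toReal) Q := by
    refine (hint.add (integrable_const |Real.log (((n : ℝ) + 1) ^ (-a))|)).mono'
      (Real.measurable_log.comp hd.ennreal_toReal).aestronglyMeasurable ?_
    filter_upwards [hlow] with u hu
    rw [Real.norm_eq_abs, abs_le]
    simp only [Pi.add_apply]
    have ht : 0 ≤ (dens k w P₀ x n u).toReal := ENNReal.toReal_nonneg
    have h1 := Real.log_le_self ht
    exact ⟨by linarith [neg_abs_le (Real.log (((n : ℝ) + 1) ^ (-a)))],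
      by linarith [abs_nonneg (Real.log (((n : ℝ) + 1) ^ (-a)))]⟩
  refine ⟨hfin.mono fun _ h => h.ne, hi, ?_, ?_⟩
  · have := integral_mono_ae (integrable_const _) hi hlow
    rwa [integral_const, probReal_univ, one_smul] at this
  · exact (integral_mono hi hint fun _ => Real.log_le_self ENNReal.toReal_nonneg).trans hup

theorem RegularKernel.logDens_drift (H : RegularKernel k M P₀ C) (ha0 : 0 < a)
    (ha : a < 1 / 4) (hw : ∀ n : ℕ, w (n + 1) = a / ((n : ℝ) + 2)) {Q : Measure 𝕌}
    [IsProbabilityMeasure Q] {c : ℝ} (hQc : Dominating P₀ Q c) {B : ℝ≥0}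
    (hQ : Q ≤ (B : ℝ≥0∞) • P₀) (n : ℕ) (x : ℕ → 𝕏) :
    logDens k w P₀ Q n x + a / ((n : ℝ) + 2) *
        (gain k M P₀ Q - gain k M P₀ (estimate k w P₀ x n)) -
        2 * (a / ((n : ℝ) + 2)) ^ 2 * (C / (((n : ℝ) + 1) ^ (-a)) ^ 2 + 1) ≤
      ∫ y, logDens k w P₀ Q (n + 1) (Function.update x (n + 1) y) ∂M := by
  have h2 : (0 : ℝ) < n + 2 := by positivity
  have hw0 : 0 ≤ w (n + 1) := by rw [hw]; positivity
  have hle : w (n + 1) ≤ 1 / 2 := by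
    rw [hw, div_le_iff₀ h2]; linarith [(Nat.cast_nonneg n : (0 : ℝ) ≤ n)]
  have hP := dominating_estimate (P₀ := P₀) H.meas ha0 ha hw x n
  obtain ⟨hi1, hi2, hdrift⟩ := H.ratio_drift hP hQc hw0 hle
  obtain ⟨hfin, hlog, -, -⟩ := integrable_log_dens H.meas ha0 ha hw hQ n x
  -- The density is updated by a factor, so its integrated logarithm gains exactly the increment
  -- estimated by `ratio_drift`.
  have e : ∀ᵐ y ∂M, logDens k w P₀ Q (n + 1) (Function.update x (n + 1) y) =
      logDens k w P₀ Q n x + ∫ u, Real.log (1 - w (n + 1) + w (n + 1) *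
        (ratio k (estimate k w P₀ x n) y u).toReal) ∂Q := by
    filter_upwards [hi1, H.mixture_ne_zero hP] with y hy hy0
    rw [logDens, logDens, ← integral_add hlog hy]
    refine integral_congr_ae ?_
    filter_upwards [hfin] with u hu
    have hr : ratio k (estimate k w P₀ x n) y u ≠ ∞ := ENNReal.div_ne_top ENNReal.coe_ne_top hy0
    have hd0 : dens k w P₀ x n u ≠ 0 := by
      have := le_dens (k := k) (P₀ := P₀) ha0 ha hw x n u
      refine (lt_of_lt_of_le ?_ this).ne'
      simp only [ENNReal.ofReal_pos]
      positivity
    rw [dens_update, ← estimate_eq_withDensity H.meas, ENNReal.toReal_mul, Real.log_mul]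
    · congr 2
      rw [ENNReal.toReal_add ENNReal.ofReal_ne_top (ENNReal.mul_ne_top ENNReal.ofReal_ne_top hr),
        ENNReal.toReal_mul, ENNReal.toReal_ofReal (by linarith), ENNReal.toReal_ofReal hw0]
    · exact (ENNReal.toReal_pos hd0 hu).ne'
    · refine (ENNReal.toReal_pos ?_ ?_).ne'
      · have : ENNReal.ofReal (1 - w (n + 1)) ≠ 0 := by
          rw [Ne, ENNReal.ofReal_eq_zero]; linarith
        simp [this]
      · exact ENNReal.add_ne_top.2
          ⟨ENNReal.ofReal_ne_top, ENNReal.mul_ne_top ENNReal.ofReal_ne_top hr⟩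
  rw [integral_congr_ae e, integral_add (integrable_const _) hi2, integral_const, probReal_univ,
    one_smul]
  rw [hw] at hdrift ⊢
  linarith

end Recursion

/-! ### Independent samples -/

section Sampling

variable {𝕏 : Type*} [MeasurableSpace 𝕏]

/-- The sequence `x` with the entries after time `n` replaced by `x₀`. -/
def trunc (x₀ : 𝕏) (n : ℕ) (x : ℕ → 𝕏) : ℕ → 𝕏 := fun i => if i ≤ n then x i else x₀

theorem measurable_trunc (x₀ : 𝕏) (n : ℕ) : Measurable (trunc x₀ n) := by
  refine measurable_pi_lambda _ fun i => ?_
  unfold trunc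
  split_ifs
  · exact measurable_pi_apply i
  · exact measurable_const

theorem trunc_of_le {x₀ : 𝕏} {n i : ℕ} (h : i ≤ n) (x : ℕ → 𝕏) : trunc x₀ n x i = x i := if_pos h

theorem trunc_trunc_succ (x₀ : 𝕏) (n : ℕ) (x : ℕ → 𝕏) :
    trunc x₀ n (trunc x₀ (n + 1) x) = trunc x₀ n x := by
  funext i
  unfold trunc
  split_ifs <;> first | rfl | omega

theorem update_trunc (x₀ : 𝕏) (n : ℕ) (x : ℕ → 𝕏) :
    Function.update (trunc x₀ n x) (n + 1) (x (n + 1)) = trunc x₀ (n + 1) x := by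
  funext i
  rcases eq_or_ne i (n + 1) with rfl | h
  · simp [trunc]
  · rw [Function.update_of_ne h]
    unfold trunc
    split_ifs <;> first | rfl | omega

variable {Ω : Type*} [mΩ : MeasurableSpace Ω] {μ : Measure Ω} [IsProbabilityMeasure μ]
  {X : ℕ → Ω → 𝕏} {M : Measure 𝕏} [IsProbabilityMeasure M]

theorem measurable_trunc_sample (hX : ∀ i, Measurable (X i)) (x₀ : 𝕏) (n : ℕ) :
    Measurable fun ω => trunc x₀ n fun i => X i ω :=
  (measurable_trunc x₀ n).comp (measurable_pi_lambda _ hX)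

/-- The filtration generated by the sample. -/
def sampleFiltration (hX : ∀ i, Measurable (X i)) (x₀ : 𝕏) : Filtration ℕ mΩ where
  seq n := MeasurableSpace.comap (fun ω => trunc x₀ n fun i => X i ω) MeasurableSpace.pi
  mono' := by
    refine monotone_nat_of_le_succ fun n => ?_
    have e : (fun ω => trunc x₀ n fun i => X i ω) =
        trunc x₀ n ∘ fun ω => trunc x₀ (n + 1) fun i => X i ω := by
      funext ω
      exact (trunc_trunc_succ x₀ n _).symm
    rw [e, ← MeasurableSpace.comap_comp]
    exact MeasurableSpace.comap_mono (measurable_trunc x₀ n).comap_le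
  le' n := (measurable_trunc_sample hX x₀ n).comap_le

theorem indepFun_trunc (hX : ∀ i, Measurable (X i)) (hI : iIndepFun X μ) (x₀ : 𝕏) (n : ℕ) :
    IndepFun (fun ω => trunc x₀ n fun i => X i ω) (X (n + 1)) μ := by
  have h := hI.indepFun_finset (Finset.range (n + 1)) {n + 1} (by simp) hX
  let φ : (Finset.range (n + 1) → 𝕏) → ℕ → 𝕏 := fun y i =>
    if hi : i ∈ Finset.range (n + 1) then y ⟨i, hi⟩ else x₀
  let ψ : (({n + 1} : Finset ℕ) → 𝕏) → 𝕏 := fun y => y ⟨n + 1, by simp⟩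
  have hφ : Measurable φ := by
    refine measurable_pi_lambda _ fun i => ?_
    by_cases hi : i ∈ Finset.range (n + 1)
    · simpa only [φ, hi, dif_pos] using measurable_pi_apply _
    · simp only [φ, hi]
      exact measurable_const
  have hψ : Measurable ψ := measurable_pi_apply _
  have hc := h.comp hφ hψ
  refine (hc : IndepFun _ (X (n + 1)) μ).congr ?_ ?_
  · refine ae_of_all _ fun ω => ?_
    funext i
    simp only [φ, Function.comp, trunc, Finset.mem_range, Nat.lt_succ_iff]
    split_ifs <;> rfl
  · rfl

theorem map_trunc_prod (hX : ∀ i, Measurable (X i)) (hI : iIndepFun X μ)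
    (hM : ∀ i, μ.map (X i) = M) (x₀ : 𝕏) (n : ℕ) :
    μ.map (fun ω => (trunc x₀ n fun i => X i ω, X (n + 1) ω)) =
      (μ.map fun ω => trunc x₀ n fun i => X i ω).prod M := by
  rw [(indepFun_iff_map_prod_eq_prod_map_map (measurable_trunc_sample hX x₀ n).aemeasurable
    (hX _).aemeasurable).1 (indepFun_trunc hX hI x₀ n), hM]

/-- A one-step drift bound for every past passes to integrals over events of the past. -/
theorem setIntegral_drift (hX : ∀ i, Measurable (X i)) (hI : iIndepFun X μ)
    (hM : ∀ i, μ.map (X i) = M) (x₀ : 𝕏) (n : ℕ) {Φ Ψ : (ℕ → 𝕏) → ℝ} (hΦ : Measurable Φ)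
    (hΨ : Measurable Ψ) {B c : ℝ} (hΦB : ∀ x, |Φ x| ≤ B) (hΨB : ∀ x, |Ψ x| ≤ B)
    (hΦt : ∀ x, Φ (trunc x₀ n x) = Φ x) (hΨt : ∀ x, Ψ (trunc x₀ (n + 1) x) = Ψ x)
    (hd : ∀ x, Φ x - c ≤ ∫ y, Ψ (Function.update x (n + 1) y) ∂M) {s : Set Ω}
    (hs : MeasurableSet[sampleFiltration hX x₀ n] s) :
    ∫ ω in s, Φ (fun i => X i ω) ∂μ - c * μ.real s ≤ ∫ ω in s, Ψ (fun i => X i ω) ∂μ := by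
  obtain ⟨A, hA, rfl⟩ := hs
  set T : Ω → ℕ → 𝕏 := fun ω => trunc x₀ n fun i => X i ω with hT
  have hTm : Measurable T := measurable_trunc_sample hX x₀ n
  have hTp : Measurable fun ω => (T ω, X (n + 1) ω) := hTm.prodMk (hX _)
  have hmap := map_trunc_prod hX hI hM x₀ n
  have : IsProbabilityMeasure (μ.map T) := Measure.isProbabilityMeasure_map hTm.aemeasurable
  have hup : Measurable fun z : (ℕ → 𝕏) × 𝕏 => Function.update z.1 (n + 1) z.2 := by
    refine measurable_pi_lambda _ fun i => ?_
    rcases eq_or_ne i (n + 1) with rfl | h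
    · simpa using measurable_snd
    · simp only [Function.update_of_ne h]
      fun_prop
  have hG : Measurable fun z : (ℕ → 𝕏) × 𝕏 => Ψ (Function.update z.1 (n + 1) z.2) := hΨ.comp hup
  have hGi : Integrable (fun z : (ℕ → 𝕏) × 𝕏 => Ψ (Function.update z.1 (n + 1) z.2))
      ((μ.map T).prod M) :=
    (integrable_const B).mono' hG.aestronglyMeasurable (ae_of_all _ fun z => hΨB _)
  -- The past T and the new observation are independent, so their joint law is a product; inserting
  -- X (n + 1) into T rebuilds the next truncation.
  have e1 : ∫ ω in T ⁻¹' A, Ψ (fun i => X i ω) ∂μ =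
      ∫ x in A, ∫ y, Ψ (Function.update x (n + 1) y) ∂M ∂(μ.map T) := by
    have h1 := setIntegral_prod (μ := μ.map T) (ν := M) (s := A) (t := Set.univ)
      (fun z : (ℕ → 𝕏) × 𝕏 => Ψ (Function.update z.1 (n + 1) z.2)) hGi.integrableOn
    simp only [Measure.restrict_univ] at h1
    rw [← h1, ← hmap, setIntegral_map (hA.prod MeasurableSet.univ) hG.aestronglyMeasurable
      hTp.aemeasurable]
    have e2 : (fun ω => (T ω, X (n + 1) ω)) ⁻¹' (A ×ˢ Set.univ) = T ⁻¹' A := by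
      ext ω; simp
    rw [e2]
    refine integral_congr_ae (ae_of_all _ fun ω => ?_)
    simp only [hT]
    rw [update_trunc x₀ n (fun i => X i ω), hΨt]
  have e3 : ∫ ω in T ⁻¹' A, Φ (fun i => X i ω) ∂μ = ∫ x in A, Φ x ∂(μ.map T) := by
    rw [setIntegral_map hA hΦ.aestronglyMeasurable hTm.aemeasurable]
    refine integral_congr_ae (ae_of_all _ fun ω => ?_)
    exact (hΦt _).symm
  have hΦi : Integrable Φ (μ.map T) :=
    (integrable_const B).mono' hΦ.aestronglyMeasurable (ae_of_all _ hΦB)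
  have e4 : c * μ.real (T ⁻¹' A) = ∫ _ in A, c ∂(μ.map T) := by
    rw [setIntegral_const, map_measureReal_apply hTm hA, smul_eq_mul, mul_comm]
  rw [e1, e3, e4, ← integral_sub hΦi.integrableOn (integrable_const c)]
  exact integral_mono (hΦi.integrableOn.sub (integrable_const c))
    hGi.integral_prod_left.integrableOn hd

end Sampling

/-! ### Almost sure behaviour of the recursion -/

section Convergence

variable {𝕏 𝕌 : Type*} [MeasurableSpace 𝕏] [MeasurableSpace 𝕌] {k : 𝕏 → 𝕌 → ℝ≥0} {w : ℕ → ℝ}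
  {P₀ : Measure 𝕌} [IsProbabilityMeasure P₀] {M : Measure 𝕏} [IsProbabilityMeasure M] {C : ℝ≥0}
  {a : ℝ} {Ω : Type*} [mΩ : MeasurableSpace Ω] {μ : Measure Ω} [IsProbabilityMeasure μ]
  {X : ℕ → Ω → 𝕏}

/-- Mass can be lost only when the predictive density at the new observation is 0 or ∞. For each
fixed past this has M-measure zero, and independence carries it over to the sample. -/
theorem RegularKernel.ae_isProbabilityMeasure_estimate (H : RegularKernel k M P₀ C) (ha0 : 0 < a)
    (ha : a < 1 / 4) (hw : ∀ n : ℕ, w (n + 1) = a / ((n : ℝ) + 2)) (hX : ∀ i, Measurable (X i))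
    (hI : iIndepFun X μ) (hM : ∀ i, μ.map (X i) = M) :
    ∀ᵐ ω ∂μ, ∀ n, IsProbabilityMeasure (estimate k w P₀ (fun i => X i ω) n) := by
  obtain ⟨ω₀⟩ : Nonempty Ω := μ.nonempty_of_neZero
  set x₀ := X 0 ω₀
  have key : ∀ n, ∀ᵐ ω ∂μ, mixture k (estimate k w P₀ (fun i => X i ω) n) (X (n + 1) ω) ≠ 0 ∧
      mixture k (estimate k w P₀ (fun i => X i ω) n) (X (n + 1) ω) ≠ ∞ := by
    intro n
    have hTp : Measurable fun ω => (trunc x₀ n fun i => X i ω, X (n + 1) ω) :=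
      (measurable_trunc_sample hX x₀ n).prodMk (hX _)
    obtain ⟨m, hmdef⟩ : ∃ m : (ℕ → 𝕏) × 𝕏 → ℝ≥0∞, ∀ z, m z = mixture k (estimate k w P₀ z.1 n) z.2 :=
      ⟨_, fun _ => rfl⟩
    have hm : Measurable m := by
      have h := measurable_mixture_withDensity (P₀ := P₀) H.meas
        (measurable_dens (w := w) (P₀ := P₀) H.meas n)
      have e : m = fun z => mixture k (P₀.withDensity (dens k w P₀ z.1 n)) z.2 :=
        funext fun z => by rw [hmdef, estimate_eq_withDensity H.meas]
      rwa [e]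
    have hprod : ∀ᵐ z ∂(μ.map fun ω => trunc x₀ n fun i => X i ω).prod M, m z ≠ 0 ∧ m z ≠ ∞ := by
      refine Measure.ae_prod_iff_ae_ae ?_ |>.2 (ae_of_all _ fun x => ?_)
      · exact (hm (measurableSet_singleton 0).compl).inter (hm (measurableSet_singleton ∞).compl)
      · have hP := dominating_estimate (P₀ := P₀) H.meas ha0 ha hw x n
        filter_upwards [H.mixture_ne_zero hP, H.mixture_ne_top hP.mass_le] with y h0 h1
        simp only [hmdef]
        exact ⟨h0, h1⟩
    rw [← map_trunc_prod hX hI hM x₀ n] at hprod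
    filter_upwards [ae_of_ae_map hTp.aemeasurable hprod] with ω hω
    rwa [hmdef, estimate_congr (y := fun i => X i ω) fun i hi =>
      trunc_of_le hi fun i => X i ω] at hω
  filter_upwards [ae_all_iff.2 key] with ω hω n
  constructor
  induction n with
  | zero => exact measure_univ (μ := P₀)
  | succ n ih =>
    have h2 : (0 : ℝ) < n + 2 := by positivity
    have hlt : w (n + 1) < 1 := by
      rw [hw, div_lt_one h2]; linarith [(Nat.cast_nonneg n : (0 : ℝ) ≤ n)]
    rw [estimate, update_univ H.meas, ih, ENNReal.div_self (hω n).1 (hω n).2, mul_one, mul_one,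
      ← ENNReal.ofReal_add (by linarith) (by rw [hw]; positivity)]
    simp

/-- If `S` is an upper bound of the expected log-likelihood along the recursion, and is approached
by mixing distributions with density bounded above and below, then it is the almost sure limit. -/
theorem RegularKernel.ae_tendsto_gain (H : RegularKernel k M P₀ C) (ha0 : 0 < a)
    (ha : a < 1 / 4) (hw : ∀ n : ℕ, w (n + 1) = a / ((n : ℝ) + 2)) (hX : ∀ i, Measurable (X i))
    (hI : iIndepFun X μ) (hM : ∀ i, μ.map (X i) = M) {S : ℝ}
    (hS : ∀ᵐ ω ∂μ, ∀ n, gain k M P₀ (estimate k w P₀ (fun i => X i ω) n) ≤ S)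
    (happ : ∀ δ > 0, ∃ Q : Measure 𝕌, IsProbabilityMeasure Q ∧ (∃ c, Dominating P₀ Q c) ∧
      (∃ B : ℝ≥0, Q ≤ (B : ℝ≥0∞) • P₀) ∧ S - δ ≤ gain k M P₀ Q) :
    ∀ᵐ ω ∂μ, Tendsto (fun n => gain k M P₀ (estimate k w P₀ (fun i => X i ω) n)) atTop (𝓝 S) := by
  obtain ⟨ω₀⟩ : Nonempty Ω := μ.nonempty_of_neZero
  set x₀ := X 0 ω₀
  set Φ : ℕ → (ℕ → 𝕏) → ℝ := fun n x => gain k M P₀ (estimate k w P₀ x n) with hΦdef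
  set G : ℕ → Ω → ℝ := fun n ω => Φ n fun i => X i ω with hG
  set ε : ℕ → ℝ := fun n =>
    2 * (a / ((n : ℝ) + 2)) ^ 2 * ((C : ℝ) ^ 2 / (((n : ℝ) + 1) ^ (-a)) ^ 4 + 1) with hε
  have hε0 : ∀ n, 0 ≤ ε n := fun n => by positivity
  have hεs : Summable ε := summable_drift_error ha0.le ha (by positivity) le_rfl
  set E := ∑' n, ε n
  have hεE : ∀ n, ∑ i ∈ Finset.range n, ε i ≤ E := fun n => hεs.sum_le_tsum _ fun i _ => hε0 i
  have hΦm : ∀ n, Measurable (Φ n) := measurable_gain H.meas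
  have hΦlow : ∀ (n : ℕ) x, Real.log (((n : ℝ) + 1) ^ (-a)) ≤ Φ n x := fun n x =>
    (H.integrable_log (dominating_estimate H.meas ha0 ha hw x n)).2
  have hΦup : ∀ n x, Φ n x ≤ C + 1 := fun n x =>
    H.gain_le (dominating_estimate H.meas ha0 ha hw x n)
  have hΦabs : ∀ n x, |Φ n x| ≤ |Real.log (((n : ℝ) + 1) ^ (-a))| + (C + 1) := by
    intro n x
    have h1 := hΦlow n x
    have h2 := hΦup n x
    have h3 := neg_abs_le (Real.log (((n : ℝ) + 1) ^ (-a)))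
    have h4 := abs_nonneg (Real.log (((n : ℝ) + 1) ^ (-a)))
    have h5 : (0 : ℝ) ≤ C := C.2
    exact abs_le.2 ⟨by linarith, by linarith⟩
  have hΦt : ∀ n x, Φ n (trunc x₀ n x) = Φ n x := fun n x => by
    simp only [hΦdef]
    rw [estimate_congr fun i hi => trunc_of_le hi x]
  have hXm : Measurable fun ω i => X i ω := measurable_pi_lambda _ hX
  have hGm : ∀ n, Measurable (G n) := fun n => (hΦm n).comp hXm
  have hGi : ∀ n, Integrable (G n) μ := fun n =>
    (integrable_const _).mono' (hGm n).aestronglyMeasurable (ae_of_all _ fun ω => hΦabs n _)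
  -- Adding the accumulated errors compensates the possible decrease of the gain.
  set V : ℕ → Ω → ℝ := fun n ω => G n ω + ∑ i ∈ Finset.range n, ε i with hV
  have hVi : ∀ n, Integrable (V n) μ := fun n => (hGi n).add (integrable_const _)
  have hsub : Submartingale V (sampleFiltration hX x₀) μ := by
    refine submartingale_of_setIntegral_le_succ (fun n => ?_) hVi fun n s hs => ?_
    · refine Measurable.stronglyMeasurable (Measurable.add_const ?_ _)
      have e : G n = Φ n ∘ fun ω => trunc x₀ n fun i => X i ω := by
        funext ω
        exact (hΦt n _).symm
      rw [e]
      exact (hΦm n).comp (comap_measurable _)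
    · have h := setIntegral_drift hX hI hM x₀ n (hΦm n) (hΦm (n + 1))
        (B := |Real.log (((n : ℝ) + 1) ^ (-a))| + |Real.log (((n + 1 : ℕ) + 1 : ℝ) ^ (-a))| +
          (C + 1)) (c := ε n)
        (fun x => (hΦabs n x).trans (by
          linarith [abs_nonneg (Real.log (((n + 1 : ℕ) + 1 : ℝ) ^ (-a)))]))
        (fun x => (hΦabs (n + 1) x).trans (by
          linarith [abs_nonneg (Real.log (((n : ℝ) + 1) ^ (-a)))]))
        (hΦt n) (hΦt (n + 1)) (H.gain_estimate_drift ha0 ha hw n) hs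
      simp only [hV]
      rw [integral_add (hGi n).integrableOn (integrable_const _),
        integral_add (hGi (n + 1)).integrableOn (integrable_const _), Finset.sum_range_succ]
      simp only [setIntegral_const, smul_eq_mul]
      simp only [hG]
      linarith
  have hmono : Monotone fun n => ∫ ω, V n ω ∂μ := by
    refine monotone_nat_of_le_succ fun n => ?_
    have := hsub.setIntegral_le (Nat.le_succ n) (s := Set.univ) MeasurableSet.univ
    simpa using this
  have hVup : ∀ n ω, V n ω ≤ C + 1 + E := fun n ω => add_le_add (hΦup n _) (hεE n)
  have hE0 : 0 ≤ E := tsum_nonneg hε0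
  have hC0 : (0 : ℝ) ≤ C := C.2
  have hbdd : ∀ n, eLpNorm (V n) 1 μ ≤
      ((2 * (C + 1 + E) - ∫ ω, V 0 ω ∂μ).toNNReal : ℝ≥0∞) := by
    intro n
    rw [eLpNorm_one_eq_lintegral_enorm, ← ofReal_integral_norm_eq_lintegral_enorm (hVi n)]
    refine ENNReal.ofReal_le_ofReal ?_
    -- An upper bound D ≥ 0 on V gives |V| ≤ 2D - V, and the means of V increase, so V is bounded in
    -- L¹.
    have h1 : ∫ ω, ‖V n ω‖ ∂μ ≤ ∫ ω, (2 * (C + 1 + E) - V n ω) ∂μ := by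
      refine integral_mono (hVi n).norm ((integrable_const _).sub (hVi n)) fun ω => ?_
      simp only [Real.norm_eq_abs]
      rw [abs_le]
      have := hVup n ω
      exact ⟨by linarith, by linarith⟩
    rw [integral_sub (integrable_const _) (hVi n), integral_const, probReal_univ, one_smul] at h1
    have := hmono (Nat.zero_le n)
    simp only at this
    linarith
  have hconv := hsub.exists_ae_tendsto_of_bdd hbdd
  have hsumlim : Tendsto (fun n => ∑ i ∈ Finset.range n, ε i) atTop (𝓝 E) :=
    hεs.hasSum.tendsto_sum_nat
  obtain ⟨l, hl⟩ : ∃ l, Tendsto (fun n => ∫ ω, G n ω ∂μ) atTop (𝓝 l) := by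
    have hb : BddAbove (Set.range fun n => ∫ ω, V n ω ∂μ) := by
      refine ⟨C + 1 + E, ?_⟩
      rintro _ ⟨n, rfl⟩
      have := integral_mono (hVi n) (integrable_const _) (hVup n)
      rwa [integral_const, probReal_univ, one_smul] at this
    refine ⟨_, ((tendsto_atTop_ciSup hmono hb).sub hsumlim).congr fun n => ?_⟩
    simp only [hV]
    rw [integral_add (hGi n) (integrable_const _), integral_const, probReal_univ, one_smul,
      add_sub_cancel_right]
  -- For an admissible Q within δ of S, the mean integrated log-density is bounded above and has
  -- drift w(`gain Q` - E `gain P_n`), which forces `gain Q` ≤ l.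
  have hSl : S ≤ l := by
    refine le_of_forall_pos_le_add fun δ hδ => ?_
    obtain ⟨Q, hQp, ⟨c, hQc⟩, ⟨B, hQB⟩, hQS⟩ := happ δ hδ
    have hJ := fun n x => (integrable_log_dens (k := k) (w := w) H.meas ha0 ha hw hQB n x).2.2
    have hJm : ∀ n, Measurable (logDens k w P₀ Q n) := measurable_logDens H.meas Q
    have hJabs : ∀ n x, |logDens k w P₀ Q n x| ≤ |Real.log (((n : ℝ) + 1) ^ (-a))| + B := by
      intro n x
      have h1 := hJ n x
      have h3 := neg_abs_le (Real.log (((n : ℝ) + 1) ^ (-a)))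
      have h4 := abs_nonneg (Real.log (((n : ℝ) + 1) ^ (-a)))
      have h5 : (0 : ℝ) ≤ B := B.2
      exact abs_le.2 ⟨by linarith, by linarith⟩
    have hJi : ∀ n, Integrable (fun ω => logDens k w P₀ Q n fun i => X i ω) μ := fun n =>
      (integrable_const _).mono' ((hJm n).comp hXm).aestronglyMeasurable
        (ae_of_all _ fun ω => hJabs n _)
    have hJt : ∀ n x, logDens k w P₀ Q n (trunc x₀ n x) = logDens k w P₀ Q n x := fun n x => by
      simp only [logDens]
      rw [dens_congr fun i hi => trunc_of_le hi x]
    have hlim := le_limit_of_drift (ℓ := gain k M P₀ Q) (B := B)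
      (j := fun n => ∫ ω, logDens k w P₀ Q n (fun i => X i ω) ∂μ)
      (w := fun n => a / ((n : ℝ) + 2))
      (c := fun n => 2 * (a / ((n : ℝ) + 2)) ^ 2 * (C / (((n : ℝ) + 1) ^ (-a)) ^ 2 + 1))
      hl (fun n => by positivity) (not_summable_weights ha0) (fun n => by positivity)
      (summable_drift_error ha0.le ha hC0 (by norm_num)) (fun n => ?_) (fun n => ?_)
    · linarith
    · set v : ℝ := a / ((n : ℝ) + 2)
      have hv : 0 ≤ v := by positivity
      obtain ⟨D, hD⟩ : ∃ D : ℝ, ∀ x, |logDens k w P₀ Q n x + v * (gain k M P₀ Q - Φ n x)| ≤ D := by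
        refine ⟨(|Real.log (((n : ℝ) + 1) ^ (-a))| + B) + v * (|gain k M P₀ Q| +
          (|Real.log (((n : ℝ) + 1) ^ (-a))| + (C + 1))), fun x => ?_⟩
        refine (abs_add_le _ _).trans (add_le_add (hJabs n x) ?_)
        rw [abs_mul, abs_of_nonneg hv]
        gcongr
        exact (abs_sub _ _).trans (add_le_add le_rfl (hΦabs n x))
      have h := setIntegral_drift hX hI hM x₀ n
        (Φ := fun x => logDens k w P₀ Q n x + v * (gain k M P₀ Q - Φ n x))
        (Ψ := logDens k w P₀ Q (n + 1))
        ((hJm n).add (((hΦm n).const_sub _).const_mul _)) (hJm (n + 1))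
        (B := max D (|Real.log (((n + 1 : ℕ) + 1 : ℝ) ^ (-a))| + B))
        (fun x => (hD x).trans (le_max_left _ _))
        (fun x => (hJabs (n + 1) x).trans (le_max_right _ _))
        (fun x => by simp only [hJt, hΦt]) (hJt (n + 1))
        (H.logDens_drift ha0 ha hw hQc hQB n) (s := Set.univ) MeasurableSet.univ
      simp only [Measure.restrict_univ, probReal_univ, mul_one] at h
      have hGi' : Integrable (fun ω => Φ n fun i => X i ω) μ := hGi n
      have hDi : Integrable (fun ω => v * (gain k M P₀ Q - Φ n fun i => X i ω)) μ :=
        ((integrable_const _).sub hGi').const_mul v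
      rw [integral_add (hJi n) hDi, integral_const_mul,
        integral_sub (integrable_const _) hGi', integral_const, probReal_univ, one_smul] at h
      exact h
    · have := integral_mono (hJi n) (integrable_const _) fun ω => (hJ n _).2
      rwa [integral_const, probReal_univ, one_smul] at this
  -- S - G is almost surely nonnegative and its means tend to S - l ≤ 0, so the lower limit vanishes
  -- almost surely.
  have hFatou : ∫⁻ ω, liminf (fun n => ENNReal.ofReal (S - G n ω)) atTop ∂μ = 0 := by
    refine le_antisymm ?_ zero_le
    refine (lintegral_liminf_le fun n => ((hGm n).const_sub S).ennreal_ofReal).trans ?_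
    have e : ∀ n, ∫⁻ ω, ENNReal.ofReal (S - G n ω) ∂μ = ENNReal.ofReal (S - ∫ ω, G n ω ∂μ) := by
      intro n
      have hDi : Integrable (fun ω => S - G n ω) μ := (integrable_const S).sub (hGi n)
      rw [← ofReal_integral_eq_lintegral_ofReal hDi,
        integral_sub (integrable_const S) (hGi n), integral_const, probReal_univ, one_smul]
      filter_upwards [hS] with ω hω
      simpa using hω n
    simp_rw [e]
    have ht : Tendsto (fun n => ENNReal.ofReal (S - ∫ ω, G n ω ∂μ)) atTop
        (𝓝 (ENNReal.ofReal (S - l))) :=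
      (ENNReal.continuous_ofReal.tendsto _).comp (hl.const_sub S)
    rw [ht.liminf_eq, ENNReal.ofReal_of_nonpos (by linarith)]
  rw [lintegral_eq_zero_iff (.liminf fun n => ((hGm n).const_sub S).ennreal_ofReal)] at hFatou
  filter_upwards [hconv, hS, hFatou] with ω ⟨v, hv⟩ hωS hω0
  have hg : Tendsto (fun n => G n ω) atTop (𝓝 (v - E)) := by
    refine (hv.sub hsumlim).congr fun n => ?_
    simp [hV]
  have ht : Tendsto (fun n => ENNReal.ofReal (S - G n ω)) atTop
      (𝓝 (ENNReal.ofReal (S - (v - E)))) :=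
    (ENNReal.continuous_ofReal.tendsto _).comp (hg.const_sub S)
  rw [ht.liminf_eq] at hω0
  have h1 : S - (v - E) ≤ 0 := by simpa using hω0
  have h2 : v - E ≤ S := le_of_tendsto' hg hωS
  have h3 : v - E = S := by linarith
  rwa [h3] at hg

end Convergence

/-! ### Approximation by mixing distributions with bounded density -/

section Smoothing

/-- Near x every r-ball contains the ball of radius r/2 about x, which has positive mass;
compactness makes the bound uniform. -/
theorem exists_pos_le_measure_ball {𝕌 : Type*} [PseudoMetricSpace 𝕌] [CompactSpace 𝕌]
    [MeasurableSpace 𝕌] (P₀ : Measure 𝕌) [P₀.IsOpenPosMeasure] {r : ℝ} (hr : 0 < r) :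
    ∃ β : ℝ≥0∞, β ≠ 0 ∧ ∀ v, β ≤ P₀ (Metric.ball v r) := by
  have h : ∃ β : ℝ≥0∞, β ≠ 0 ∧ ∀ v ∈ (Set.univ : Set 𝕌), β ≤ P₀ (Metric.ball v r) := by
    refine isCompact_univ.induction_on (p := fun s => ∃ β : ℝ≥0∞, β ≠ 0 ∧
      ∀ v ∈ s, β ≤ P₀ (Metric.ball v r)) ⟨1, one_ne_zero, by simp⟩ ?_ ?_ ?_
    · rintro s t hst ⟨β, hβ, h⟩
      exact ⟨β, hβ, fun v hv => h v (hst hv)⟩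
    · rintro s t ⟨β, hβ, h⟩ ⟨γ, hγ, h'⟩
      refine ⟨min β γ, ?_, ?_⟩
      · rcases min_choice β γ with e | e <;> rw [e] <;> assumption
      · rintro v (hv | hv)
        · exact (min_le_left _ _).trans (h v hv)
        · exact (min_le_right _ _).trans (h' v hv)
    · intro x _
      refine ⟨Metric.ball x (r / 2), mem_nhdsWithin_of_mem_nhds (Metric.ball_mem_nhds x (by linarith)),
        P₀ (Metric.ball x (r / 2)), (Metric.measure_ball_pos P₀ x (by linarith)).ne', ?_⟩
      intro v hv
      refine measure_mono (Metric.ball_subset_ball' ?_)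
      rw [Metric.mem_ball, dist_comm] at hv
      linarith
  obtain ⟨β, hβ, h⟩ := h
  exact ⟨β, hβ, fun v => h v (Set.mem_univ v)⟩

/-- A coupling of `Q` with a measure of bounded density whose coordinates are `r`-close. -/
theorem exists_coupling_bounded_density {𝕌 : Type*} [PseudoMetricSpace 𝕌] [CompactSpace 𝕌]
    [MeasurableSpace 𝕌] [BorelSpace 𝕌] (P₀ : Measure 𝕌) [IsProbabilityMeasure P₀]
    [P₀.IsOpenPosMeasure] (Q : Measure 𝕌) [IsProbabilityMeasure Q] {r : ℝ} (hr : 0 < r) :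
    ∃ π : Measure (𝕌 × 𝕌), π.map Prod.fst = Q ∧
      (∃ B : ℝ≥0, π.map Prod.snd ≤ (B : ℝ≥0∞) • P₀) ∧ ∀ᵐ z ∂π, dist z.2 z.1 < r := by
  obtain ⟨β, hβ, hball⟩ := exists_pos_le_measure_ball P₀ hr
  set S : Set (𝕌 × 𝕌) := {z | dist z.2 z.1 < r} with hSdef
  have hS : MeasurableSet S :=
    (isOpen_lt (continuous_snd.dist continuous_fst) continuous_const).measurableSet
  have hb : Measurable fun v => P₀ (Metric.ball v r) := measurable_measure_prodMk_left hS
  -- Given the first coordinate v, the second is drawn from P_0 conditioned on the r-ball about v.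
  -- The uniform ball bound β gives the density bound 1/β.
  set g : 𝕌 × 𝕌 → ℝ≥0∞ := S.indicator fun z => (P₀ (Metric.ball z.1 r))⁻¹ with hgdef
  have hg : Measurable g := (hb.comp measurable_fst).inv.indicator hS
  have hgle : ∀ z, g z ≤ β⁻¹ := fun z => by
    refine (Set.indicator_le_self' (fun _ _ => zero_le) z).trans ?_
    exact ENNReal.inv_le_inv.2 (hball _)
  have hg1 : ∀ v, ∫⁻ u, g (v, u) ∂P₀ = 1 := by
    intro v
    have e : (fun u => g (v, u)) =
        (Metric.ball v r).indicator fun _ => (P₀ (Metric.ball v r))⁻¹ := by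
      funext u
      simp only [hgdef, Set.indicator, hSdef, Set.mem_ofPred_eq, Metric.mem_ball]
    rw [e, lintegral_indicator_const Metric.isOpen_ball.measurableSet, ENNReal.inv_mul_cancel]
    · exact (Metric.measure_ball_pos P₀ v hr).ne'
    · exact measure_ne_top _ _
  refine ⟨(Q.prod P₀).withDensity g, ?_, ⟨β⁻¹.toNNReal, ?_⟩, ?_⟩
  · ext A hA
    rw [Measure.map_apply measurable_fst hA, withDensity_apply _ (measurable_fst hA),
      ← Set.prod_univ, ← Measure.prod_restrict, Measure.restrict_univ,
      lintegral_prod _ hg.aemeasurable]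
    simp [hg1]
  · refine Measure.le_iff.2 fun A hA => ?_
    rw [ENNReal.coe_toNNReal (ENNReal.inv_ne_top.2 hβ), Measure.map_apply measurable_snd hA,
      withDensity_apply _ (measurable_snd hA)]
    calc ∫⁻ z in Prod.snd ⁻¹' A, g z ∂(Q.prod P₀)
        ≤ ∫⁻ _ in Prod.snd ⁻¹' A, β⁻¹ ∂(Q.prod P₀) := lintegral_mono fun z => hgle z
      _ = β⁻¹ * (Q.prod P₀) (Prod.snd ⁻¹' A) := setLIntegral_const _ _
      _ = (β⁻¹ • P₀) A := by
        rw [← Set.univ_prod, Measure.prod_prod]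
        simp
  · rw [ae_withDensity_iff hg]
    refine ae_of_all _ fun z hz => ?_
    exact (Set.mem_of_indicator_ne_zero hz : z ∈ S)

/-- Couplings at distance below 1/(t+1) give weak convergence, as continuous functions on a compact
space are uniformly continuous. -/
theorem exists_tendsto_bounded_density {𝕌 : Type*} [TopologicalSpace 𝕌] [CompactSpace 𝕌]
    [TopologicalSpace.MetrizableSpace 𝕌] [MeasurableSpace 𝕌] [BorelSpace 𝕌] (P₀ : Measure 𝕌)
    [IsProbabilityMeasure P₀] [P₀.IsOpenPosMeasure] (Q' : ProbabilityMeasure 𝕌) :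
    ∃ Q : ℕ → ProbabilityMeasure 𝕌, Tendsto Q atTop (𝓝 Q') ∧
      ∀ t, ∃ B : ℝ≥0, (Q t : Measure 𝕌) ≤ (B : ℝ≥0∞) • P₀ := by
  let _ := TopologicalSpace.metrizableSpaceMetric 𝕌
  choose π hfst hsnd hclose using fun t : ℕ =>
    exists_coupling_bounded_density P₀ (Q' : Measure 𝕌) (r := 1 / ((t : ℝ) + 1)) (by positivity)
  have hπ : ∀ t, IsProbabilityMeasure (π t) := fun t => by
    constructor
    have := congrArg (fun ρ : Measure 𝕌 => ρ Set.univ) (hfst t)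
    simpa [Measure.map_apply measurable_fst MeasurableSet.univ] using this
  refine ⟨fun t => (⟨(π t).map Prod.snd,
    Measure.isProbabilityMeasure_map measurable_snd.aemeasurable⟩ : ProbabilityMeasure 𝕌), ?_, hsnd⟩
  refine ProbabilityMeasure.tendsto_iff_forall_integral_tendsto.2 fun f => ?_
  rw [Metric.tendsto_atTop]
  intro η hη
  obtain ⟨ρ, hρ, hf⟩ := Metric.uniformContinuous_iff.1
    (CompactSpace.uniformContinuous_of_continuous f.continuous) (η / 2) (by linarith)
  obtain ⟨N, hN⟩ := exists_nat_one_div_lt hρ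
  refine ⟨N, fun t ht => ?_⟩
  have e1 : ∫ u, f u ∂((π t).map Prod.snd) = ∫ z, f z.2 ∂(π t) :=
    integral_map measurable_snd.aemeasurable f.continuous.measurable.aestronglyMeasurable
  have e2 : ∫ u, f u ∂(Q' : Measure 𝕌) = ∫ z, f z.1 ∂(π t) := by
    rw [← hfst t]
    exact integral_map measurable_fst.aemeasurable f.continuous.measurable.aestronglyMeasurable
  have i1 : Integrable (fun z : 𝕌 × 𝕌 => f z.2) (π t) :=
    (integrable_const ‖f‖).mono' (f.continuous.measurable.comp measurable_snd).aestronglyMeasurable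
      (ae_of_all _ fun z => f.norm_coe_le_norm _)
  have i2 : Integrable (fun z : 𝕌 × 𝕌 => f z.1) (π t) :=
    (integrable_const ‖f‖).mono' (f.continuous.measurable.comp measurable_fst).aestronglyMeasurable
      (ae_of_all _ fun z => f.norm_coe_le_norm _)
  have key : dist (∫ u, f u ∂((π t).map Prod.snd)) (∫ u, f u ∂(Q' : Measure 𝕌)) ≤ η / 2 := by
    rw [dist_eq_norm, e1, e2, ← integral_sub i1 i2]
    refine (norm_integral_le_of_norm_le_const (C := η / 2) ?_).trans (by simp)
    filter_upwards [hclose t] with z hz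
    rw [← dist_eq_norm]
    refine (hf (hz.trans_le ?_)).le
    refine le_trans ?_ hN.le
    have : (N : ℝ) ≤ t := by exact_mod_cast ht
    gcongr
  exact key.trans_lt (by linarith)

end Smoothing

/-! ### Blending with P₀ and approximation of the gain -/

section Approximation

variable {𝕏 𝕌 : Type*} [MeasurableSpace 𝕏] [MeasurableSpace 𝕌]

/-- The mixture `(1 - ε) Q + ε P₀`. -/
noncomputable def blend (P₀ Q : Measure 𝕌) (ε : ℝ) : Measure 𝕌 :=
  ENNReal.ofReal (1 - ε) • Q + ENNReal.ofReal ε • P₀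

variable {P₀ Q : Measure 𝕌} [IsProbabilityMeasure P₀] [IsProbabilityMeasure Q] {ε : ℝ}

theorem isProbabilityMeasure_blend (h0 : 0 < ε) (h1 : ε < 1) :
    IsProbabilityMeasure (blend P₀ Q ε) := by
  constructor
  simp only [blend, Measure.coe_add, Measure.coe_smul, Pi.add_apply, Pi.smul_apply, measure_univ,
    smul_eq_mul, mul_one]
  rw [← ENNReal.ofReal_add (by linarith) h0.le]
  simp

theorem dominating_blend (h0 : 0 < ε) (h1 : ε < 1) : Dominating P₀ (blend P₀ Q ε) ε where
  mass_le := by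
    have := isProbabilityMeasure_blend (P₀ := P₀) (Q := Q) h0 h1
    exact prob_le_one
  pos := h0
  le := Measure.le_add_left le_rfl

omit [IsProbabilityMeasure P₀] [IsProbabilityMeasure Q] in
theorem mixture_blend (k : 𝕏 → 𝕌 → ℝ≥0) (x : 𝕏) :
    mixture k (blend P₀ Q ε) x =
      ENNReal.ofReal (1 - ε) * mixture k Q x + ENNReal.ofReal ε * mixture k P₀ x := by
  simp only [mixture, blend, lintegral_add_measure, lintegral_smul_measure, smul_eq_mul]

omit [IsProbabilityMeasure P₀] [IsProbabilityMeasure Q] in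
theorem blend_le {B : ℝ≥0} (hQ : Q ≤ (B : ℝ≥0∞) • P₀) (h0 : 0 < ε) (h1 : ε < 1) :
    blend P₀ Q ε ≤ ((B + 1 : ℝ≥0) : ℝ≥0∞) • P₀ := by
  refine Measure.le_iff.2 fun s _ => ?_
  have h := hQ s
  simp only [blend, Measure.coe_add, Measure.coe_smul, Pi.add_apply, Pi.smul_apply,
    smul_eq_mul] at h ⊢
  push_cast
  rw [add_mul, one_mul]
  refine add_le_add ((mul_le_of_le_one_left' ?_).trans h) (mul_le_of_le_one_left' ?_)
  · exact ENNReal.ofReal_le_one.2 (by linarith)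
  · exact ENNReal.ofReal_le_one.2 h1.le

variable {k : 𝕏 → 𝕌 → ℝ≥0} {M : Measure 𝕏} [IsProbabilityMeasure M] {C : ℝ≥0}

/-- Concavity of the logarithm at m_Q/m_0 and 1; the P_0 part contributes log 1 = 0. -/
theorem RegularKernel.le_gain_blend (H : RegularKernel k M P₀ C)
    (hQ0 : ∀ᵐ x ∂M, mixture k Q x ≠ 0)
    (hQi : Integrable (fun x => Real.log (mixture k Q x / mixture k P₀ x).toReal) M)
    (h0 : 0 < ε) (h1 : ε < 1) : (1 - ε) * gain k M P₀ Q ≤ gain k M P₀ (blend P₀ Q ε) := by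
  rw [gain, gain, ← integral_const_mul]
  refine integral_mono_ae (hQi.const_mul _) (H.integrable_log (dominating_blend h0 h1)).1 ?_
  filter_upwards [H.ne_zero, H.ne_top, hQ0, H.mixture_ne_top (P := Q) prob_le_one] with x a b c d
  simp only [mixture_blend, ENNReal.add_div, mul_div_assoc, ENNReal.div_self a b, mul_one]
  set t := mixture k Q x / mixture k P₀ x with ht
  have ht0 : t ≠ 0 := ENNReal.div_ne_zero.2 ⟨c, b⟩
  have htt : t ≠ ∞ := ENNReal.div_ne_top d a
  rw [ENNReal.toReal_add (ENNReal.mul_ne_top ENNReal.ofReal_ne_top htt) ENNReal.ofReal_ne_top,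
    ENNReal.toReal_mul, ENNReal.toReal_ofReal (by linarith), ENNReal.toReal_ofReal h0.le]
  have := strictConcaveOn_log_Ioi.concaveOn.2 (Set.mem_Ioi.2 (ENNReal.toReal_pos ht0 htt))
    (Set.mem_Ioi.2 one_pos) (sub_nonneg.2 h1.le) h0.le (sub_add_cancel 1 ε)
  simpa using this

/-- Mixtures by distributions with density bounded above and below approach the expected
log-likelihood of any mixture. -/
theorem RegularKernel.exists_gain_ge [TopologicalSpace 𝕌] [CompactSpace 𝕌]
    [TopologicalSpace.MetrizableSpace 𝕌] [BorelSpace 𝕌] [P₀.IsOpenPosMeasure]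
    (H : RegularKernel k M P₀ C)
    (hweak : ∀ (Q : ℕ → ProbabilityMeasure 𝕌) (Q' : ProbabilityMeasure 𝕌),
      Tendsto Q atTop (𝓝 Q') →
        ∀ᵐ x ∂M, Tendsto (fun t => mixture k (Q t : Measure 𝕌) x) atTop
          (𝓝 (mixture k (Q' : Measure 𝕌) x)))
    (Q' : ProbabilityMeasure 𝕌) (hQ0 : ∀ᵐ x ∂M, mixture k (Q' : Measure 𝕌) x ≠ 0)
    (hQi : Integrable (fun x =>
      Real.log (mixture k (Q' : Measure 𝕌) x / mixture k P₀ x).toReal) M) {δ : ℝ} (hδ : 0 < δ) :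
    ∃ Q : Measure 𝕌, IsProbabilityMeasure Q ∧ (∃ c, Dominating P₀ Q c) ∧
      (∃ B : ℝ≥0, Q ≤ (B : ℝ≥0∞) • P₀) ∧ gain k M P₀ (Q' : Measure 𝕌) - δ ≤ gain k M P₀ Q := by
  obtain ⟨Q, hQ, hQB⟩ := exists_tendsto_bounded_density P₀ Q'
  set s := gain k M P₀ (Q' : Measure 𝕌)
  obtain ⟨ε, h0, h1, hε⟩ : ∃ ε : ℝ, 0 < ε ∧ ε < 1 ∧ ε * s ≤ δ / 2 := by
    refine ⟨min (1 / 2) (δ / (2 * (|s| + 1))), by positivity, ?_, ?_⟩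
    · exact (min_le_left _ _).trans_lt (by norm_num)
    · calc min (1 / 2) (δ / (2 * (|s| + 1))) * s
          ≤ min (1 / 2) (δ / (2 * (|s| + 1))) * (|s| + 1) := by
            gcongr
            linarith [le_abs_self s]
        _ ≤ δ / (2 * (|s| + 1)) * (|s| + 1) := by gcongr; exact min_le_right _ _
        _ = δ / 2 := by
            have : 0 < |s| + 1 := by positivity
            field_simp
  have hblend := H.le_gain_blend hQ0 hQi h0 h1
  suffices h : ∃ t, gain k M P₀ (blend P₀ (Q' : Measure 𝕌) ε) - δ / 2 ≤
      gain k M P₀ (blend P₀ (Q t : Measure 𝕌) ε) by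
    obtain ⟨t, ht⟩ := h
    obtain ⟨B, hB⟩ := hQB t
    refine ⟨blend P₀ (Q t : Measure 𝕌) ε, isProbabilityMeasure_blend h0 h1,
      ⟨ε, dominating_blend h0 h1⟩, ⟨B + 1, blend_le hB h0 h1⟩, ?_⟩
    have e : (1 - ε) * s = s - ε * s := by ring
    change s - δ ≤ _
    change (1 - ε) * s ≤ _ at hblend
    linarith
  by_contra! hcon
  set A := gain k M P₀ (blend P₀ (Q' : Measure 𝕌) ε)
  -- The blended ratio is at least ε, so subtracting log ε makes the integrand nonnegative, as Fatou
  -- requires. Only this lower semicontinuity of the gain is needed.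
  set F : Measure 𝕌 → 𝕏 → ℝ := fun R x =>
    Real.log (mixture k (blend P₀ R ε) x / mixture k P₀ x).toReal - Real.log ε with hF
  have hFint : ∀ R : ProbabilityMeasure 𝕌,
      ∫⁻ x, ENNReal.ofReal (F R x) ∂M =
        ENNReal.ofReal (gain k M P₀ (blend P₀ (R : Measure 𝕌) ε) - Real.log ε) := by
    intro R
    have hi := (H.integrable_log (dominating_blend (P₀ := P₀) (Q := (R : Measure 𝕌)) h0 h1)).1
    have hi' : Integrable (F R) M := hi.sub (integrable_const _)
    rw [← ofReal_integral_eq_lintegral_ofReal hi', hF, integral_sub hi (integrable_const _),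
      integral_const, probReal_univ, one_smul]
    · rfl
    filter_upwards [H.ne_zero, H.ne_top, H.mixture_ne_top (P := (R : Measure 𝕌)) prob_le_one]
      with x a b d
    simp only [hF, Pi.zero_apply, sub_nonneg, mixture_blend, ENNReal.add_div, mul_div_assoc,
      ENNReal.div_self a b, mul_one]
    refine Real.log_le_log h0 ?_
    rw [← ENNReal.ofReal_le_iff_le_toReal]
    · exact le_add_self
    · exact ENNReal.add_ne_top.2 ⟨ENNReal.mul_ne_top ENNReal.ofReal_ne_top
        (ENNReal.div_ne_top d a), ENNReal.ofReal_ne_top⟩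
  have hFm : ∀ R : ProbabilityMeasure 𝕌, Measurable fun x => ENNReal.ofReal (F R x) := by
    intro R
    have := isProbabilityMeasure_blend (P₀ := P₀) (Q := (R : Measure 𝕌)) h0 h1
    exact ((Real.measurable_log.comp ((measurable_mixture H.meas _).div
      (measurable_mixture H.meas P₀)).ennreal_toReal).sub_const _).ennreal_ofReal
  have hlim : ∀ᵐ x ∂M, liminf (fun t => ENNReal.ofReal (F (Q t) x)) atTop =
      ENNReal.ofReal (F Q' x) := by
    filter_upwards [hweak Q Q' hQ, H.ne_zero, H.ne_top,
      H.mixture_ne_top (P := (Q' : Measure 𝕌)) prob_le_one] with x hx a b d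
    refine Tendsto.liminf_eq ?_
    refine (ENNReal.continuous_ofReal.tendsto _).comp (Tendsto.sub_const ?_ _)
    simp only [mixture_blend, ENNReal.add_div, mul_div_assoc, ENNReal.div_self a b, mul_one]
    have htop : ENNReal.ofReal (1 - ε) * (mixture k (Q' : Measure 𝕌) x / mixture k P₀ x) +
        ENNReal.ofReal ε ≠ ∞ :=
      ENNReal.add_ne_top.2 ⟨ENNReal.mul_ne_top ENNReal.ofReal_ne_top (ENNReal.div_ne_top d a),
        ENNReal.ofReal_ne_top⟩
    have hne : ENNReal.ofReal (1 - ε) * (mixture k (Q' : Measure 𝕌) x / mixture k P₀ x) +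
        ENNReal.ofReal ε ≠ 0 := by
      simp [h0]
    refine Tendsto.log ((ENNReal.tendsto_toReal htop).comp ?_) (ENNReal.toReal_pos hne htop).ne'
    refine Tendsto.add_const (ENNReal.ofReal ε) ?_
    exact ENNReal.Tendsto.const_mul (ENNReal.Tendsto.div_const hx (Or.inr a))
      (Or.inr ENNReal.ofReal_ne_top)
  have hfat := lintegral_liminf_le (μ := M) (u := atTop) fun t => hFm (Q t)
  rw [lintegral_congr_ae hlim, hFint] at hfat
  simp_rw [hFint] at hfat
  have hlow : ∀ t, Real.log ε ≤ gain k M P₀ (blend P₀ (Q t : Measure 𝕌) ε) := fun t =>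
    (H.integrable_log (dominating_blend h0 h1)).2
  have hup : liminf (fun t => ENNReal.ofReal
      (gain k M P₀ (blend P₀ (Q t : Measure 𝕌) ε) - Real.log ε)) atTop ≤
      ENNReal.ofReal (A - δ / 2 - Real.log ε) := by
    refine liminf_le_of_frequently_le' (Frequently.of_forall fun t => ?_)
    exact ENNReal.ofReal_le_ofReal (by linarith [hcon t])
  have h3 := hfat.trans hup
  have h4 := (hlow 0).trans_lt (hcon 0)
  rw [ENNReal.ofReal_le_ofReal_iff (by linarith)] at h3
  linarith

end Approximation

/-! ### Kullback–Leibler divergence of densities -/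

section Divergence

open InformationTheory

variable {𝕏 : Type*} [MeasurableSpace 𝕏] {ν : Measure 𝕏} {f : 𝕏 → ℝ≥0} {g : 𝕏 → ℝ≥0∞}

theorem withDensity_absolutelyContinuous_withDensity_iff (hg : Measurable g) :
    ν.withDensity (fun x => (f x : ℝ≥0∞)) ≪ ν.withDensity g ↔
      ∀ᵐ x ∂ν.withDensity (fun x => (f x : ℝ≥0∞)), g x ≠ 0 := by
  constructor
  · intro h
    exact h.ae_le ((ae_withDensity_iff hg).2 (ae_of_all _ fun _ h => h))
  · intro h
    refine Measure.AbsolutelyContinuous.mk fun s _ hs0 => ?_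
    have h1 : ∀ᵐ x ∂ν.withDensity g, x ∉ s := measure_eq_zero_iff_ae_notMem.1 hs0
    rw [ae_withDensity_iff hg] at h1
    refine measure_eq_zero_iff_ae_notMem.2 ?_
    filter_upwards [h, (withDensity_absolutelyContinuous ν _).ae_le h1] with x a b using b a

/-- Positivity of g wherever f is positive lets f·ν be written as (f/g)·(g·ν), which identifies the
Radon–Nikodym derivative as f/g. -/
theorem llr_withDensity (hf : Measurable f) (hg : Measurable g) (hg1 : ∫⁻ x, g x ∂ν = 1)
    (h0 : ∀ᵐ x ∂ν.withDensity (fun x => (f x : ℝ≥0∞)), g x ≠ 0) :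
    llr (ν.withDensity fun x => (f x : ℝ≥0∞)) (ν.withDensity g)
      =ᵐ[ν.withDensity fun x => (f x : ℝ≥0∞)]
        fun x => Real.log (f x) - Real.log (g x).toReal := by
  have hfm : Measurable fun x => (f x : ℝ≥0∞) := hf.coe_nnreal_ennreal
  have hdm : Measurable fun x => (f x : ℝ≥0∞) / g x := hfm.div hg
  have hgt : ∀ᵐ x ∂ν, g x < ∞ := ae_lt_top hg (by simp [hg1])
  have : IsProbabilityMeasure (ν.withDensity g) :=
    ⟨by rw [withDensity_apply _ MeasurableSet.univ, Measure.restrict_univ, hg1]⟩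
  have hac := (withDensity_absolutelyContinuous_withDensity_iff (ν := ν) (f := f) hg).2 h0
  have hfac : ν.withDensity (fun x => (f x : ℝ≥0∞)) =
      (ν.withDensity g).withDensity fun x => (f x : ℝ≥0∞) / g x := by
    rw [← withDensity_mul _ hg hdm]
    refine withDensity_congr_ae ?_
    filter_upwards [hgt, (ae_withDensity_iff hfm).1 h0] with x hx hx0
    simp only [Pi.mul_apply]
    by_cases hfx : (f x : ℝ≥0∞) = 0
    · simp [hfx]
    · rw [ENNReal.mul_div_cancel (hx0 hfx) hx.ne]
  have hrn : (ν.withDensity fun x => (f x : ℝ≥0∞)).rnDeriv (ν.withDensity g)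
      =ᵐ[ν.withDensity fun x => (f x : ℝ≥0∞)] fun x => (f x : ℝ≥0∞) / g x := by
    have h := Measure.rnDeriv_withDensity (ν.withDensity g) hdm
    rw [← hfac] at h
    exact hac.ae_le h
  have hfpos : ∀ᵐ x ∂ν.withDensity (fun x => (f x : ℝ≥0∞)), (f x : ℝ≥0∞) ≠ 0 :=
    (ae_withDensity_iff hfm).2 (ae_of_all _ fun _ h => h)
  filter_upwards [hrn, h0, hfpos, (withDensity_absolutelyContinuous ν _).ae_le hgt]
    with x hx a b c
  rw [llr, hx, ENNReal.toReal_div, ENNReal.coe_toReal, Real.log_div]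
  · simpa using b
  · exact (ENNReal.toReal_pos a c.ne).ne'

/-- For two probability measures the mass correction in `klDiv` cancels; nonnegativity ensures that
`ENNReal.ofReal` loses nothing. -/
theorem KL_eq_ofReal (hf : Measurable f) (hf1 : ∫⁻ x, (f x : ℝ≥0∞) ∂ν = 1) (hg : Measurable g)
    (hg1 : ∫⁻ x, g x ∂ν = 1)
    (h0 : ∀ᵐ x ∂ν.withDensity (fun x => (f x : ℝ≥0∞)), g x ≠ 0)
    (hi : Integrable (fun x => Real.log (f x) - Real.log (g x).toReal)
      (ν.withDensity fun x => (f x : ℝ≥0∞))) :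
    KL ν (fun x => (f x : ℝ≥0∞)) g = ENNReal.ofReal (∫ x, (Real.log (f x) - Real.log (g x).toReal)
      ∂ν.withDensity (fun x => (f x : ℝ≥0∞))) ∧
    0 ≤ ∫ x, (Real.log (f x) - Real.log (g x).toReal)
      ∂ν.withDensity (fun x => (f x : ℝ≥0∞)) := by
  have hac := (withDensity_absolutelyContinuous_withDensity_iff (ν := ν) (f := f) hg).2 h0
  have hllr := llr_withDensity hf hg hg1 h0
  have : IsProbabilityMeasure (ν.withDensity g) :=
    ⟨by rw [withDensity_apply _ MeasurableSet.univ, Measure.restrict_univ, hg1]⟩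
  have : IsProbabilityMeasure (ν.withDensity fun x => (f x : ℝ≥0∞)) :=
    ⟨by rw [withDensity_apply _ MeasurableSet.univ, Measure.restrict_univ, hf1]⟩
  have hi' := (integrable_congr hllr).2 hi
  have hnn := integral_llr_add_sub_measure_univ_nonneg hac hi'
  rw [KL, klDiv_of_ac_of_integrable hac hi']
  rw [integral_congr_ae hllr] at hnn ⊢
  simp only [probReal_univ, add_sub_cancel_right] at hnn ⊢
  exact ⟨trivial, hnn⟩

theorem of_KL_ne_top (hf : Measurable f) (hg : Measurable g) (hg1 : ∫⁻ x, g x ∂ν = 1)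
    (h : KL ν (fun x => (f x : ℝ≥0∞)) g ≠ ∞) :
    (∀ᵐ x ∂ν.withDensity (fun x => (f x : ℝ≥0∞)), g x ≠ 0) ∧
    Integrable (fun x => Real.log (f x) - Real.log (g x).toReal)
      (ν.withDensity fun x => (f x : ℝ≥0∞)) := by
  obtain ⟨hac, hi⟩ := klDiv_ne_top_iff.1 h
  have h0 := (withDensity_absolutelyContinuous_withDensity_iff hg).1 hac
  exact ⟨h0, (integrable_congr (llr_withDensity hf hg hg1 h0)).1 hi⟩

end Divergence

/-! ### Divergence of mixtures in terms of the gain -/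

section MixtureDivergence

variable {𝕏 𝕌 : Type*} [MeasurableSpace 𝕏] [MeasurableSpace 𝕌] {ν : Measure 𝕏} [SigmaFinite ν]
  {k : 𝕏 → 𝕌 → ℝ≥0} {f : 𝕏 → ℝ≥0} {P₀ : Measure 𝕌} [IsProbabilityMeasure P₀] {C : ℝ≥0}

theorem lintegral_mixture (hk : Measurable (Function.uncurry k))
    (hk1 : ∀ u, ∫⁻ x, (k x u : ℝ≥0∞) ∂ν = 1) (P : Measure 𝕌) [IsProbabilityMeasure P] :
    ∫⁻ x, mixture k P x ∂ν = 1 := by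
  unfold mixture
  rw [lintegral_lintegral_swap hk.coe_nnreal_ennreal.aemeasurable]
  simp [hk1]

/-- Finiteness of the divergence at one mixture makes the initial mixture positive and its
divergence finite. -/
theorem regularKernel_of_KL_ne_top (hk : Measurable (Function.uncurry k))
    (hk1 : ∀ u, ∫⁻ x, (k x u : ℝ≥0∞) ∂ν = 1) (hf : Measurable f)
    (hf1 : ∫⁻ x, (f x : ℝ≥0∞) ∂ν = 1)
    (hsq : ∀ u, ∫⁻ x, ratio k P₀ x u ^ 2 ∂ν.withDensity (fun x => (f x : ℝ≥0∞)) ≤ C)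
    {Q : Measure 𝕌} [IsProbabilityMeasure Q]
    (hQ : KL ν (fun x => (f x : ℝ≥0∞)) (mixture k Q) ≠ ∞) :
    RegularKernel k (ν.withDensity fun x => (f x : ℝ≥0∞)) P₀ C ∧
    Integrable (fun x => Real.log (f x) - Real.log (mixture k P₀ x).toReal)
      (ν.withDensity fun x => (f x : ℝ≥0∞)) := by
  have hfm : Measurable fun x => (f x : ℝ≥0∞) := hf.coe_nnreal_ennreal
  have hm0 := measurable_mixture hk P₀
  have hmQ := measurable_mixture hk Q
  obtain ⟨hQ0, hQi⟩ := of_KL_ne_top hf hmQ (lintegral_mixture hk hk1 Q) hQ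
  set M := ν.withDensity fun x => (f x : ℝ≥0∞) with hM
  have hMp : IsProbabilityMeasure M :=
    ⟨by rw [withDensity_apply _ MeasurableSet.univ, Measure.restrict_univ, hf1]⟩
  have hfin := lintegral_mixture_div_le hk hsq (P := Q) prob_le_one
  have hfin' := (hfin.trans_lt (by finiteness)).ne
  have hdm : Measurable fun x => mixture k Q x / mixture k P₀ x := hmQ.div hm0
  -- m_Q/m_0 has finite mean and m_Q is nonzero, whereas m_0 = 0 would make the quotient ∞.
  have hne0 : ∀ᵐ x ∂M, mixture k P₀ x ≠ 0 := by
    filter_upwards [ae_lt_top hdm hfin', hQ0] with x hx hx0 h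
    rw [h, ENNReal.div_zero hx0] at hx
    exact lt_irrefl _ hx
  have htop : ∀ᵐ x ∂M, mixture k P₀ x ≠ ∞ := by
    refine (withDensity_absolutelyContinuous ν _).ae_le ?_
    filter_upwards [ae_lt_top hm0 (by simp [lintegral_mixture hk hk1 P₀])] with x hx using hx.ne
  have H : RegularKernel k M P₀ C := ⟨hk, hne0, htop, hsq⟩
  refine ⟨H, ?_⟩
  have hr := (H.integrable_div (P := Q) prob_le_one).1
  have hsm : Measurable fun x => mixture k P₀ x / f x := hm0.div hfm
  have hs : Integrable (fun x => (mixture k P₀ x / f x).toReal) M := by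
    refine integrable_toReal_of_lintegral_ne_top hsm.aemeasurable ?_
    rw [hM, lintegral_withDensity_eq_lintegral_mul _ hfm hsm]
    refine ne_top_of_le_ne_top (b := 1) ENNReal.one_ne_top ?_
    rw [← lintegral_mixture hk hk1 P₀]
    exact lintegral_mono fun x => ENNReal.mul_div_le
  have hfpos : ∀ᵐ x ∂M, (f x : ℝ≥0∞) ≠ 0 :=
    (ae_withDensity_iff hfm).2 (ae_of_all _ fun _ h => h)
  -- From above, log(f/m_0) = log(f/m_Q) + log(m_Q/m_0) with log t ≤ t; from below, log(m_0/f) ≤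
  -- m_0/f, whose M-mean is at most 1.
  refine ((hQi.abs.add hr).add hs).mono' (Measurable.aestronglyMeasurable ?_) ?_
  · exact (Real.measurable_log.comp hf.coe_nnreal_real).sub
      (Real.measurable_log.comp hm0.ennreal_toReal)
  filter_upwards [hne0, htop, hQ0, H.mixture_ne_top (P := Q) prob_le_one, hfpos] with x a b c d e
  have ha := ENNReal.toReal_pos a b
  have hc := ENNReal.toReal_pos c d
  have he : (0 : ℝ) < f x := by
    simpa [pos_iff_ne_zero] using e
  simp only [Pi.add_apply, ENNReal.toReal_div, ENNReal.coe_toReal]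
  have h1 := Real.log_le_self (div_pos hc ha).le
  have h2 := Real.log_le_self (div_pos ha he).le
  have h3 := (div_pos hc ha).le
  have h4 := (div_pos ha he).le
  rw [Real.log_div hc.ne' ha.ne'] at h1
  rw [Real.log_div ha.ne' he.ne'] at h2
  have h5 := abs_nonneg (Real.log (f x) - Real.log (mixture k Q x).toReal)
  have h6 := le_abs_self (Real.log (f x) - Real.log (mixture k Q x).toReal)
  rw [Real.norm_eq_abs, abs_le]
  exact ⟨by linarith, by linarith⟩

/-- The divergence of a mixture in terms of its expected log-likelihood ratio against the initial
mixture. -/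
theorem RegularKernel.KL_mixture (hk1 : ∀ u, ∫⁻ x, (k x u : ℝ≥0∞) ∂ν = 1) (hf : Measurable f)
    (hf1 : ∫⁻ x, (f x : ℝ≥0∞) ∂ν = 1)
    (H : RegularKernel k (ν.withDensity fun x => (f x : ℝ≥0∞)) P₀ C)
    (hi0 : Integrable (fun x => Real.log (f x) - Real.log (mixture k P₀ x).toReal)
      (ν.withDensity fun x => (f x : ℝ≥0∞))) (P : Measure 𝕌) [IsProbabilityMeasure P]
    (hP0 : ∀ᵐ x ∂ν.withDensity (fun x => (f x : ℝ≥0∞)), mixture k P x ≠ 0) :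
    let M := ν.withDensity fun x => (f x : ℝ≥0∞)
    let K₀ := ∫ x, (Real.log (f x) - Real.log (mixture k P₀ x).toReal) ∂M
    (KL ν (fun x => (f x : ℝ≥0∞)) (mixture k P) ≠ ∞ →
      Integrable (fun x => Real.log (mixture k P x / mixture k P₀ x).toReal) M) ∧
    (Integrable (fun x => Real.log (mixture k P x / mixture k P₀ x).toReal) M →
      KL ν (fun x => (f x : ℝ≥0∞)) (mixture k P) = ENNReal.ofReal (K₀ - gain k M P₀ P) ∧
        0 ≤ K₀ - gain k M P₀ P) := by
  intro M K₀
  have hMp : IsProbabilityMeasure M :=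
    ⟨by rw [withDensity_apply _ MeasurableSet.univ, Measure.restrict_univ, hf1]⟩
  have hm := measurable_mixture H.meas P
  have hm1 := lintegral_mixture H.meas hk1 P
  have hlog : ∀ᵐ x ∂M, Real.log (mixture k P x / mixture k P₀ x).toReal =
      Real.log (mixture k P x).toReal - Real.log (mixture k P₀ x).toReal := by
    filter_upwards [H.ne_zero, H.ne_top, hP0, H.mixture_ne_top (P := P) prob_le_one] with x a b c d
    rw [ENNReal.toReal_div, Real.log_div (ENNReal.toReal_pos c d).ne'
      (ENNReal.toReal_pos a b).ne']
  constructor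
  · intro h
    refine (hi0.sub (of_KL_ne_top hf hm hm1 h).2).congr ?_
    filter_upwards [hlog] with x hx
    rw [hx, Pi.sub_apply]
    ring
  · intro hi
    have e : ∀ᵐ x ∂M, (Real.log (f x) - Real.log (mixture k P₀ x).toReal) -
        Real.log (mixture k P x / mixture k P₀ x).toReal =
        Real.log (f x) - Real.log (mixture k P x).toReal := by
      filter_upwards [hlog] with x hx
      rw [hx]
      ring
    have e2 : ∫ x, (Real.log (f x) - Real.log (mixture k P x).toReal) ∂M =
        K₀ - gain k M P₀ P := by
      rw [← integral_congr_ae e, integral_sub hi0 hi]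
      rfl
    have := KL_eq_ofReal hf hf1 hm hm1 hP0 ((hi0.sub hi).congr e)
    rwa [e2] at this

end MixtureDivergence

end PredRec

/-! ### Convergence of predictive recursion -/

theorem theorem1
    -- the sample space with its dominating measure, and the compact mixing support
    {𝕏 : Type*} [MeasurableSpace 𝕏] (ν : Measure 𝕏) [SigmaFinite ν]
    {𝕌 : Type*} [TopologicalSpace 𝕌] [CompactSpace 𝕌] [TopologicalSpace.MetrizableSpace 𝕌]
    [MeasurableSpace 𝕌] [BorelSpace 𝕌]
    -- the kernel: a probability density in `x` for each `u`
    (k : 𝕏 → 𝕌 → ℝ≥0) (hk_meas : Measurable (Function.uncurry k))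
    (hk_density : ∀ u, ∫⁻ x, (k x u : ℝ≥0∞) ∂ν = 1)
    -- weak convergence of mixing distributions gives a.e. convergence of mixture densities
    (hk_weak : ∀ (Q : ℕ → ProbabilityMeasure 𝕌) (Q' : ProbabilityMeasure 𝕌),
      Tendsto Q atTop (𝓝 Q') →
        ∀ᵐ x ∂ν, Tendsto (fun t => PredRec.mixture k (Q t : Measure 𝕌) x) atTop
          (𝓝 (PredRec.mixture k (Q' : Measure 𝕌) x)))
    -- the initial guess, whose support is the whole of `𝕌`
    (P₀ : Measure 𝕌) [IsProbabilityMeasure P₀] [P₀.IsOpenPosMeasure]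
    -- the family of mixing distributions, weakly dense among all distributions on `𝕌`
    (𝒟 : Set (ProbabilityMeasure 𝕌)) (h𝒟 : Dense 𝒟)
    -- the true density
    (mstar : 𝕏 → ℝ≥0) (hm_meas : Measurable mstar)
    (hm_density : ∫⁻ x, (mstar x : ℝ≥0∞) ∂ν = 1)
    (hKL_finite : ∃ m ∈ PredRec.mixtureClass k 𝒟, PredRec.KL ν (fun x => (mstar x : ℝ≥0∞)) m < ∞)
    -- the weights
    (a : ℝ) (ha_pos : 0 < a) (ha : a < 2 / 9)
    (w : ℕ → ℝ) (hw : ∀ i : ℕ, 1 ≤ i → w i = a / ((i : ℝ) + 1))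
    -- the integrability condition
    (h_int : ⨆ u : 𝕌,
      ∫⁻ x, ((k x u : ℝ≥0∞) / PredRec.mixture k P₀ x) ^ 2 * (mstar x : ℝ≥0∞) ∂ν < ∞)
    -- the data: independent, with density `mstar`
    {Ω : Type*} [MeasurableSpace Ω] (μ : Measure Ω) [IsProbabilityMeasure μ]
    (X : ℕ → Ω → 𝕏) (hX_meas : ∀ i, Measurable (X i)) (hX_indep : iIndepFun X μ)
    (hX_law : ∀ i, μ.map (X i) = ν.withDensity (fun x => (mstar x : ℝ≥0∞))) :
    (∀ᵐ ω ∂μ, Tendsto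
      (fun n => PredRec.KL ν (fun x => (mstar x : ℝ≥0∞))
        (PredRec.mixture k (PredRec.estimate k w P₀ (fun i => X i ω) n)))
      atTop (𝓝 (⨅ m ∈ PredRec.mixtureClass k 𝒟, PredRec.KL ν (fun x => (mstar x : ℝ≥0∞)) m))) ∧
    ((∃ m ∈ PredRec.mixtureClass k 𝒟, (fun x => (mstar x : ℝ≥0∞)) =ᵐ[ν] m) →
      ∀ᵐ ω ∂μ, Tendsto
        (fun n => PredRec.KL ν (fun x => (mstar x : ℝ≥0∞))
          (PredRec.mixture k (PredRec.estimate k w P₀ (fun i => X i ω) n)))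
        atTop (𝓝 0)) := by
  have hf1 : ∫⁻ x, (mstar x : ℝ≥0∞) ∂ν = 1 := hm_density
  -- Density of 𝒟 puts every mixture into the class, in particular the estimates m_n whenever P_n is
  -- a probability measure.
  have hcl : closure 𝒟 = Set.univ := h𝒟.closure_eq
  have hmem : ∀ Q : ProbabilityMeasure 𝕌,
      PredRec.mixture k (Q : Measure 𝕌) ∈ PredRec.mixtureClass k 𝒟 := fun Q =>
    ⟨Q, by rw [hcl]; exact Set.mem_univ Q, rfl⟩
  have hfm : Measurable fun x => (mstar x : ℝ≥0∞) := hm_meas.coe_nnreal_ennreal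
  have hw' : ∀ n : ℕ, w (n + 1) = a / ((n : ℝ) + 2) := fun n => by
    rw [hw (n + 1) (by omega)]
    push_cast
    rw [add_assoc, one_add_one_eq_two]
  have ha' : a < 1 / 4 := by linarith
  obtain ⟨m₁, ⟨Q₁, -, rfl⟩, hQ₁⟩ := hKL_finite
  set C : ℝ≥0 := (⨆ u : 𝕌,
    ∫⁻ x, ((k x u : ℝ≥0∞) / PredRec.mixture k P₀ x) ^ 2 * (mstar x : ℝ≥0∞) ∂ν).toNNReal with hC
  have hsq : ∀ u, ∫⁻ x, PredRec.ratio k P₀ x u ^ 2 ∂ν.withDensity (fun x => (mstar x : ℝ≥0∞)) ≤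
      C := by
    intro u
    have hr : Measurable fun x => PredRec.ratio k P₀ x u :=
      (PredRec.measurable_ratio hk_meas P₀).comp (measurable_id.prodMk measurable_const)
    rw [lintegral_withDensity_eq_lintegral_mul _ hfm (hr.pow_const 2), hC,
      ENNReal.coe_toNNReal h_int.ne]
    refine le_trans (le_of_eq ?_) (le_iSup _ u)
    refine lintegral_congr fun x => ?_
    rw [Pi.mul_apply, mul_comm]
    rfl
  obtain ⟨H, hi0⟩ := PredRec.regularKernel_of_KL_ne_top hk_meas hk_density hm_meas hf1 hsq hQ₁.ne
  have hMp : IsProbabilityMeasure (ν.withDensity fun x => (mstar x : ℝ≥0∞)) :=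
    ⟨by rw [withDensity_apply _ MeasurableSet.univ, Measure.restrict_univ, hf1]⟩
  have hKL := fun (P : Measure 𝕌) [IsProbabilityMeasure P] =>
    H.KL_mixture hk_density hm_meas hf1 hi0 P
  simp only at hKL
  set M := ν.withDensity fun x => (mstar x : ℝ≥0∞) with hM
  set K₀ := ∫ x, (Real.log (mstar x) - Real.log (PredRec.mixture k P₀ x).toReal) ∂M
  set I := ⨅ m ∈ PredRec.mixtureClass k 𝒟, PredRec.KL ν (fun x => (mstar x : ℝ≥0∞)) m with hI
  have hI_top : I ≠ ∞ := ne_top_of_le_ne_top hQ₁.ne (iInf₂_le _ (hmem Q₁))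
  have hest : ∀ (x : ℕ → 𝕏) n, IsProbabilityMeasure (PredRec.estimate k w P₀ x n) →
      PredRec.KL ν (fun x => (mstar x : ℝ≥0∞))
        (PredRec.mixture k (PredRec.estimate k w P₀ x n)) =
          ENNReal.ofReal (K₀ - PredRec.gain k M P₀ (PredRec.estimate k w P₀ x n)) ∧
        0 ≤ K₀ - PredRec.gain k M P₀ (PredRec.estimate k w P₀ x n) := by
    intro x n hp
    have hd := PredRec.dominating_estimate (P₀ := P₀) hk_meas ha_pos ha' hw' x n
    exact (hKL _ (H.mixture_ne_zero hd)).2 (H.integrable_log hd).1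
  have hprob := H.ae_isProbabilityMeasure_estimate ha_pos ha' hw' hX_meas hX_indep hX_law
  -- Here S = K₀ - inf K. Half of δ is spent on choosing a nearly optimal mixture and half on
  -- approximating it by one with two-sided density bounds.
  have hlim : ∀ᵐ ω ∂μ, Tendsto (fun n => PredRec.gain k M P₀
      (PredRec.estimate k w P₀ (fun i => X i ω) n)) atTop (𝓝 (K₀ - I.toReal)) := by
    refine H.ae_tendsto_gain ha_pos ha' hw' hX_meas hX_indep hX_law ?_ fun δ hδ => ?_
    · filter_upwards [hprob] with ω hω n
      obtain ⟨h1, h2⟩ := hest (fun i => X i ω) n (hω n)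
      have h3 : I ≤ _ := iInf₂_le _
        (hmem ⟨PredRec.estimate k w P₀ (fun i => X i ω) n, hω n⟩)
      have h4 := ENNReal.toReal_le_of_le_ofReal h2 (h3.trans h1.le)
      linarith
    · have hlt : I < I + ENNReal.ofReal (δ / 2) :=
        ENNReal.lt_add_right hI_top (by simpa using hδ)
      nth_rw 1 [hI] at hlt
      simp only [iInf_lt_iff] at hlt
      obtain ⟨m, ⟨Q, -, rfl⟩, hQ⟩ := hlt
      have hQtop := (hQ.trans_le le_top).ne
      have hQ0 := (PredRec.of_KL_ne_top hm_meas (PredRec.measurable_mixture hk_meas (Q : Measure 𝕌))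
        (PredRec.lintegral_mixture hk_meas hk_density Q) hQtop).1
      have hQi := (hKL (Q : Measure 𝕌) hQ0).1 hQtop
      obtain ⟨h1, h2⟩ := (hKL (Q : Measure 𝕌) hQ0).2 hQi
      obtain ⟨R, hR1, hR2, hR3, hR4⟩ := H.exists_gain_ge
        (fun Q Q' hQ => (withDensity_absolutelyContinuous ν _).ae_le (hk_weak Q Q' hQ))
        Q hQ0 hQi (half_pos hδ)
      refine ⟨R, hR1, hR2, hR3, ?_⟩
      have h3 : ENNReal.ofReal (K₀ - PredRec.gain k M P₀ (Q : Measure 𝕌)) ≤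
          ENNReal.ofReal (I.toReal + δ / 2) := by
        rw [ENNReal.ofReal_add ENNReal.toReal_nonneg (half_pos hδ).le, ENNReal.ofReal_toReal hI_top,
          ← h1]
        exact hQ.le
      rw [ENNReal.ofReal_le_ofReal_iff (add_nonneg ENNReal.toReal_nonneg (half_pos hδ).le)] at h3
      linarith
  have hmain : ∀ᵐ ω ∂μ, Tendsto
      (fun n => PredRec.KL ν (fun x => (mstar x : ℝ≥0∞))
        (PredRec.mixture k (PredRec.estimate k w P₀ (fun i => X i ω) n))) atTop (𝓝 I) := by
    filter_upwards [hprob, hlim] with ω hω hωl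
    have h := (ENNReal.continuous_ofReal.tendsto _).comp (hωl.const_sub K₀)
    rw [sub_sub_cancel, ENNReal.ofReal_toReal hI_top] at h
    exact h.congr fun n => (hest (fun i => X i ω) n (hω n)).1.symm
  refine ⟨hmain, ?_⟩
  rintro ⟨m, hm, hmm⟩
  -- A mixture equal to m* almost everywhere has divergence zero, so the infimum vanishes.
  have hI0 : I = 0 := by
    refine le_antisymm ((iInf₂_le m hm).trans (le_of_eq ?_)) zero_le
    rw [PredRec.KL, ← withDensity_congr_ae hmm]
    exact InformationTheory.klDiv_self M
  rwa [hI0] at hmain
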